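/- Let $k\ge 2$ be an integer, put $\kappa=2^{k-1}$, and let $\epsilon>0$. There is a constant $C>0$, depending only on $k$ and $\epsilon$, such that for every sequence $(a_n)_{n\in\mathbb Z}$ of complex numbers, all positive integers $Q$ and $N$, and every integer $M$, $$\sum_{q=1}^{Q}\frac{q}{\varphi(q)}\ \sideset{}{^{\star}}\sum_{\chi \bmod q^k}\left|\sum_{n=M+1}^{M+N}a_n\chi(n)\right|^2\le C\,\log(2Q)\left[Q^{k+1}+N^{\epsilon}\left(NQ^{\frac{\kappa-1}{\kappa}}+N^{1-\frac1\kappa}Q^{\frac{\kappa+k}{\kappa}}\right)\right]\sum_{n=M+1}^{M+N}|a_n|^2,$$ where $\sum^{\star}$ runs over the primitive Dirichlet characters $\chi$ modulo $q^k$ and $\varphi$ is Euler's totient function. -/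

import Mathlib

open Classical in
/-- The finite set of primitive complex Dirichlet characters modulo `n`. -/
noncomputable def primitiveDirichletCharacters (n : ℕ) : Finset (DirichletCharacter ℂ n) :=
  Finset.univ.filter fun χ => χ.IsPrimitive

/-! For primitive `χ` modulo `m` the Gauss sum has modulus `√m`, so `χ n` expands in additive
characters even when `n` is not coprime to `m`. Orthogonality then bounds the weighted sum over `χ`
by a sum over reduced fractions `c / q ^ k` (`sum_primitiveDirichletCharacters_le`). A large sieve
(`large_sieve_fractions`) bounds the latter by `12 N ∑ ‖a n‖ ^ 2` times the largest number of such
fractions within `1 / (6 N)` of a point. What remains is to count them for `q` in a dyadic block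
`[P, 2P)`.

If `N ≤ (2P) ^ k`, counting the numerators for each `q` separately gives the term `Q ^ (k + 1)`.
Otherwise fix one fraction `b / q₀ ^ k` near the point: any other `a / q ^ k` forces `b q ^ k` to
lie within `O(P ^ (2k) / N)` of a multiple of `q₀ ^ k`, and `q` determines `a`.

Such `q` are counted by Weyl differencing done on sets instead of exponential sums
(`exists_card_pow_mul_le`). Counting pairs by their difference and applying Hölder lowers the degree
by one; in the end the condition says that `b k! h₁ ⋯ h_k` is close to a multiple of `q₀ ^ k`. The
divisor bound groups the `h` by their product, and coprimality of `b` and `q₀` counts the products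
(`exists_boxSum_nearMultiple_le`). A `κ`-th root yields the other two terms
(`exists_mul_card_fractions_le`), and the dyadic blocks cost `log (2Q)`. -/

/-! ### Parseval, Gauss sums, and passage to additive characters -/

open ZMod in
/-- Parseval's identity for trigonometric sums with distinct frequencies in `ZMod L`. -/
theorem sum_norm_sq_sum_stdAddChar {ι : Type*} {L : ℕ} [NeZero L] (s : Finset ι) (f : ι → ZMod L)
    (hf : Set.InjOn f s) (b : ι → ℂ) :
    ∑ x : ZMod L, ‖∑ i ∈ s, b i * stdAddChar (x * f i)‖ ^ 2 = L * ∑ i ∈ s, ‖b i‖ ^ 2 := by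
  classical
  have key : ∑ x : ZMod L, ((‖∑ i ∈ s, b i * stdAddChar (x * f i)‖ ^ 2 : ℝ) : ℂ)
      = L * ∑ i ∈ s, ((‖b i‖ ^ 2 : ℝ) : ℂ) := by
    have h1 : ∀ x : ZMod L, ((‖∑ i ∈ s, b i * stdAddChar (x * f i)‖ ^ 2 : ℝ) : ℂ)
        = ∑ i ∈ s, ∑ j ∈ s, b i * (starRingEnd ℂ) (b j) * stdAddChar (x * (f i - f j)) := by
      intro x
      rw [Complex.ofReal_pow, ← Complex.mul_conj', map_sum, Finset.sum_mul_sum]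
      refine Finset.sum_congr rfl fun i _ => Finset.sum_congr rfl fun j _ => ?_
      rw [RingHom.map_mul, ← AddChar.map_neg_eq_conj, mul_sub, sub_eq_add_neg, AddChar.map_add_eq_mul]
      ring
    simp_rw [h1]
    rw [Finset.sum_comm, Finset.mul_sum]
    refine Finset.sum_congr rfl fun i hi => ?_
    rw [Finset.sum_comm, Finset.sum_eq_single i]
    · rw [← Finset.mul_sum, AddChar.sum_mulShift _ (isPrimitive_stdAddChar L), sub_self,
        if_pos rfl, ZMod.card, Complex.mul_conj']
      push_cast
      ring
    · intro j hj hji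
      rw [← Finset.mul_sum, AddChar.sum_mulShift _ (isPrimitive_stdAddChar L), if_neg]
      · simp
      · exact sub_ne_zero.mpr fun h => hji (hf hj hi h.symm)
    · exact fun h => absurd hi h
  exact_mod_cast key

open ZMod DirichletCharacter in
/-- The Gauss sum of a primitive character modulo `m` has absolute value `√m`. -/
theorem norm_sq_gaussSum_of_isPrimitive {m : ℕ} [NeZero m] {χ : DirichletCharacter ℂ m}
    (hχ : χ.IsPrimitive) : ‖gaussSum χ stdAddChar‖ ^ 2 = m := by
  -- With coefficients `χ`, primitivity makes the left side of Parseval `∑ ‖χ x‖ ^ 2` times the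
  -- squared norm of the Gauss sum; the factor `∑ ‖χ x‖ ^ 2` then cancels.
  have hP := sum_norm_sq_sum_stdAddChar (Finset.univ : Finset (ZMod m)) id
    Function.injective_id.injOn χ
  have h1 : ∀ x : ZMod m, ‖∑ i, χ i * stdAddChar (x * id i)‖ ^ 2
      = ‖χ x‖ ^ 2 * ‖gaussSum χ stdAddChar‖ ^ 2 := by
    intro x
    have := gaussSum_mulShift_of_isPrimitive (stdAddChar (N := m)) hχ x
    rw [← MulChar.star_apply'] at this
    simp only [gaussSum, AddChar.mulShift_apply] at this
    simp only [id, this, norm_mul, norm_star, mul_pow, gaussSum]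
  simp_rw [h1] at hP
  rw [← Finset.sum_mul, mul_comm] at hP
  refine mul_right_cancel₀ ?_ hP
  refine (lt_of_lt_of_le one_pos ?_).ne'
  calc (1 : ℝ) = ‖χ 1‖ ^ 2 := by simp
    _ ≤ _ := Finset.single_le_sum (f := fun x => ‖χ x‖ ^ 2) (fun _ _ => by positivity)
      (Finset.mem_univ _)

open ZMod DirichletCharacter in
/-- Orthogonality of Dirichlet characters, in the form of Parseval's identity. -/
theorem sum_norm_sq_sum_dirichletCharacter {m : ℕ} [NeZero m] (S : ZMod m → ℂ) :
    ∑ χ : DirichletCharacter ℂ m, ‖∑ a, χ a * S a‖ ^ 2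
      = m.totient * ∑ a : ZMod m with IsUnit a, ‖S a‖ ^ 2 := by
  classical
  have h0 : ∀ χ : DirichletCharacter ℂ m, ∑ a, χ a * S a
      = ∑ a : ZMod m with IsUnit a, χ a * S a := by
    intro χ
    rw [Finset.sum_filter]
    refine Finset.sum_congr rfl fun a _ => ?_
    split_ifs with h
    · rfl
    · rw [χ.map_nonunit h, zero_mul]
  have key : ∑ χ : DirichletCharacter ℂ m, ((‖∑ a, χ a * S a‖ ^ 2 : ℝ) : ℂ)
      = m.totient * ∑ a : ZMod m with IsUnit a, ((‖S a‖ ^ 2 : ℝ) : ℂ) := by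
    have h1 : ∀ χ : DirichletCharacter ℂ m, ((‖∑ a, χ a * S a‖ ^ 2 : ℝ) : ℂ)
        = ∑ a : ZMod m with IsUnit a, ∑ b : ZMod m with IsUnit b,
          S b * (starRingEnd ℂ) (S a) * (χ a⁻¹ * χ b) := by
      intro χ
      rw [h0, Complex.ofReal_pow, ← Complex.conj_mul', map_sum, Finset.sum_mul_sum]
      refine Finset.sum_congr rfl fun a ha => Finset.sum_congr rfl fun b _ => ?_
      have hinv : (starRingEnd ℂ) (χ a) = χ a⁻¹ := by
        have := MulChar.star_apply' χ a
        rw [← RCLike.star_def, this]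
        obtain ⟨u, rfl⟩ := (Finset.mem_filter.mp ha).2
        rw [MulChar.inv_apply, Ring.inverse_unit, ZMod.inv_coe_unit]
      rw [map_mul, hinv]
      ring
    simp_rw [h1]
    rw [Finset.sum_comm, Finset.mul_sum]
    refine Finset.sum_congr rfl fun a ha => ?_
    have hau : IsUnit a := (Finset.mem_filter.mp ha).2
    rw [Finset.sum_comm]
    simp_rw [← Finset.mul_sum, sum_char_inv_mul_char_eq ℂ hau]
    rw [Finset.sum_eq_single a]
    · rw [if_pos rfl, Complex.mul_conj', mul_comm]
      push_cast
      rfl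
    · intro b _ hb
      rw [if_neg hb.symm, mul_zero]
    · exact fun h => absurd ha h
  exact_mod_cast key

open ZMod DirichletCharacter in
/-- Passage from primitive multiplicative characters to additive characters. -/
theorem sum_primitiveDirichletCharacters_le {m : ℕ} (hm : 0 < m) (s : Finset ℤ) (a : ℤ → ℂ) :
    (m : ℝ) / m.totient * ∑ χ ∈ primitiveDirichletCharacters m, ‖∑ n ∈ s, a n * χ (n : ZMod m)‖ ^ 2
      ≤ ∑ c ∈ Finset.range m with c.Coprime m,
          ‖∑ n ∈ s, a n * Complex.exp (2 * Real.pi * Complex.I * (n * c) / m)‖ ^ 2 := by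
  classical
  have : NeZero m := ⟨hm.ne'⟩
  set S : ZMod m → ℂ := fun b => ∑ n ∈ s, a n * stdAddChar ((n : ZMod m) * b) with hS
  have h1 : ∀ χ ∈ primitiveDirichletCharacters m,
      (m : ℝ) * ‖∑ n ∈ s, a n * χ (n : ZMod m)‖ ^ 2 = ‖∑ b, χ⁻¹ b * S b‖ ^ 2 := by
    intro χ hχ
    have hp : χ⁻¹.IsPrimitive := by
      have := (Finset.mem_filter.mp hχ).2
      rw [isPrimitive_def] at this ⊢
      rw [conductor_inv, this]
    -- Primitivity is what makes the Gauss sum identity hold also for `n` not coprime to `m`.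
    have h2 : ∑ b, χ⁻¹ b * S b = gaussSum χ⁻¹ stdAddChar * ∑ n ∈ s, a n * χ (n : ZMod m) := by
      simp_rw [hS, Finset.mul_sum]
      rw [Finset.sum_comm]
      refine Finset.sum_congr rfl fun n _ => ?_
      have := gaussSum_mulShift_of_isPrimitive (stdAddChar (N := m)) hp (n : ZMod m)
      rw [inv_inv] at this
      rw [← mul_assoc, mul_comm _ (a n), mul_assoc, mul_comm _ (χ _), ← this, gaussSum,
        Finset.mul_sum]
      refine Finset.sum_congr rfl fun b _ => ?_
      rw [AddChar.mulShift_apply]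
      ring
    rw [h2, norm_mul, mul_pow, norm_sq_gaussSum_of_isPrimitive hp]
  have htot : (0 : ℝ) < m.totient := by exact_mod_cast Nat.totient_pos.mpr hm
  rw [div_mul_eq_mul_div, div_le_iff₀ htot, Finset.mul_sum, Finset.sum_congr rfl h1]
  calc ∑ χ ∈ primitiveDirichletCharacters m, ‖∑ b, χ⁻¹ b * S b‖ ^ 2
      ≤ ∑ χ : DirichletCharacter ℂ m, ‖∑ b, χ⁻¹ b * S b‖ ^ 2 :=
        Finset.sum_le_sum_of_subset_of_nonneg (Finset.subset_univ _) fun _ _ _ => by positivity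
    _ = ∑ χ : DirichletCharacter ℂ m, ‖∑ b, χ b * S b‖ ^ 2 :=
        Equiv.sum_comp (Equiv.inv _) fun χ : DirichletCharacter ℂ m => ‖∑ b, χ b * S b‖ ^ 2
    _ = (∑ b : ZMod m with IsUnit b, ‖S b‖ ^ 2) * m.totient := by
        rw [sum_norm_sq_sum_dirichletCharacter, mul_comm]
    _ = _ := by
        congr 1
        refine Finset.sum_bij' (fun b _ => b.val) (fun c _ => (c : ZMod m)) ?_ ?_ ?_ ?_ ?_
        · intro b hb
          have hb := (Finset.mem_filter.mp hb).2
          refine Finset.mem_filter.mpr ⟨Finset.mem_range.mpr b.val_lt, ?_⟩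
          rwa [← ZMod.isUnit_iff_coprime, ZMod.natCast_zmod_val]
        · intro c hc
          have hc := (Finset.mem_filter.mp hc).2
          exact Finset.mem_filter.mpr ⟨Finset.mem_univ _, (ZMod.isUnit_iff_coprime c m).mpr hc⟩
        · intro b _
          simp
        · intro c hc
          exact ZMod.val_cast_of_lt (Finset.mem_range.mp (Finset.mem_filter.mp hc).1)
        · intro b _
          simp only [hS]
          congr 2
          refine Finset.sum_congr rfl fun n _ => ?_
          have := stdAddChar_coe (N := m) (n * b.val)
          push_cast [ZMod.natCast_zmod_val] at this
          rw [this]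

/-! ### The large sieve on a finite cyclic group -/

-- Since `|n j| ≤ N J = L / 6`, every phase is at most `π / 3`, so each term has real part at least
-- `1 / 2`. The large sieve below divides its coefficients by this kernel.
open ZMod in
theorem half_le_norm_average_stdAddChar {L N J : ℕ} [NeZero L] (hL : L = 6 * N * J)
    (n : ℤ) (hn : |n| ≤ N) :
    (2 * J + 1 : ℝ) / 2 ≤
      ‖∑ j ∈ Finset.Icc (-(J : ℤ)) J, stdAddChar ((n : ZMod L) * (j : ZMod L))‖ := by
  have hcard : ((Finset.Icc (-(J : ℤ)) J).card : ℝ) = 2 * J + 1 := by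
    rw [Int.card_Icc]
    have : (((J : ℤ) + 1 - -J).toNat : ℤ) = 2 * J + 1 := by omega
    exact_mod_cast this
  have hL0 : (0 : ℝ) < L := by exact_mod_cast Nat.pos_of_ne_zero (NeZero.ne L)
  refine le_trans ?_ (Complex.re_le_norm _)
  rw [Complex.re_sum, ← hcard, div_eq_mul_inv, ← nsmul_eq_mul]
  refine Finset.card_nsmul_le_sum _ _ _ fun j hj => ?_
  have h := stdAddChar_coe (N := L) (n * j)
  push_cast at h
  have harg : (2 * Real.pi * Complex.I * (n * j) / L : ℂ)
      = ((2 * Real.pi * (n * j) / L : ℝ) : ℂ) * Complex.I := by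
    push_cast
    ring
  rw [h, harg, Complex.exp_ofReal_mul_I_re, ← Real.cos_abs]
  have hj' : |(j : ℝ)| ≤ J := by
    rw [Finset.mem_Icc] at hj
    rw [abs_le]
    exact ⟨by exact_mod_cast hj.1, by exact_mod_cast hj.2⟩
  have hn' : |(n : ℝ)| ≤ N := by exact_mod_cast hn
  have hb : |2 * Real.pi * (n * j) / L| ≤ Real.pi / 3 := by
    rw [abs_div, abs_mul, abs_mul, abs_of_pos Real.pi_pos, abs_of_pos hL0, abs_mul,
      div_le_iff₀ hL0, hL]
    push_cast
    rw [abs_of_pos (by norm_num : (0 : ℝ) < 2)]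
    have := mul_le_mul hn' hj' (abs_nonneg _) (Nat.cast_nonneg N)
    nlinarith [Real.pi_pos]
  have := Real.cos_le_cos_of_nonneg_of_le_pi (abs_nonneg _) (by linarith [Real.pi_pos]) hb
  rw [Real.cos_pi_div_three] at this
  linarith

open ZMod in
/-- A large sieve inequality for points of `ZMod L`, with a spacing condition that counts the
points in short arcs. -/
theorem large_sieve_zmod {ι : Type*} {L N J : ℕ} [NeZero L] (hN : 0 < N) (hJ : 0 < J)
    (hL : L = 6 * N * J) (X : Finset ι) (x : ι → ZMod L) (K : ℝ)
    (hK : ∀ y : ZMod L, (((X ×ˢ Finset.Icc (-(J : ℤ)) J).filter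
      fun p => x p.1 + (p.2 : ZMod L) = y).card : ℝ) ≤ K) (a : ℤ → ℂ) (M : ℤ) :
    ∑ i ∈ X, ‖∑ n ∈ Finset.Icc (M + 1) (M + N), a n * stdAddChar ((n : ZMod L) * x i)‖ ^ 2
      ≤ 12 * K * N * ∑ n ∈ Finset.Icc (M + 1) (M + N), ‖a n‖ ^ 2 := by
  classical
  set I := Finset.Icc (M + 1) (M + N) with hI
  set A := Finset.Icc (-(J : ℤ)) J with hA
  have hcard : (A.card : ℝ) = 2 * J + 1 := by
    rw [hA, Int.card_Icc]
    have : (((J : ℤ) + 1 - -J).toNat : ℤ) = 2 * J + 1 := by omega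
    exact_mod_cast this
  have hK0 : 0 ≤ K := (Nat.cast_nonneg _).trans (hK 0)
  -- Shifting by `M` brings the frequencies into `[1, N]`, where `g` is bounded below. With
  -- coefficients `a n / g n`, the sum at `y` becomes, up to a unimodular factor, the sum of `T`
  -- over the window `y + j`, `|j| ≤ J`.
  set g : ℤ → ℂ := fun n => ∑ j ∈ A, stdAddChar (((n - M : ℤ) : ZMod L) * (j : ZMod L)) with hg
  have hgn : ∀ n ∈ I, (2 * J + 1 : ℝ) / 2 ≤ ‖g n‖ := by
    intro n hn
    rw [hI, Finset.mem_Icc] at hn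
    refine half_le_norm_average_stdAddChar hL _ ?_
    rw [abs_le]
    omega
  have hJ1 : (0 : ℝ) < (2 * J + 1 : ℝ) / 2 := by positivity
  have hg0 : ∀ n ∈ I, g n ≠ 0 := fun n hn => norm_pos_iff.mp (hJ1.trans_le (hgn n hn))
  set b : ℤ → ℂ := fun n => a n / g n with hb
  set T : ZMod L → ℂ := fun y => ∑ n ∈ I, b n * stdAddChar (y * ((n - M : ℤ) : ZMod L)) with hT
  have hpt : ∀ y : ZMod L, ‖∑ n ∈ I, a n * stdAddChar ((n : ZMod L) * y)‖ ^ 2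
      ≤ (2 * J + 1) * ∑ j ∈ A, ‖T (y + (j : ZMod L))‖ ^ 2 := by
    intro y
    have h1 : ∑ n ∈ I, a n * stdAddChar ((n : ZMod L) * y)
        = stdAddChar ((M : ZMod L) * y) * ∑ j ∈ A, T (y + (j : ZMod L)) := by
      simp_rw [hT]
      rw [Finset.sum_comm, Finset.mul_sum]
      refine Finset.sum_congr rfl fun n hn => ?_
      have h2 : a n = b n * g n := by rw [hb]; exact (div_mul_cancel₀ _ (hg0 n hn)).symm
      rw [h2, hg, Finset.mul_sum, Finset.sum_mul, Finset.mul_sum]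
      refine Finset.sum_congr rfl fun j _ => ?_
      rw [mul_assoc, ← AddChar.map_add_eq_mul, mul_left_comm, ← AddChar.map_add_eq_mul]
      congr 2
      push_cast
      ring
    rw [h1, norm_mul, AddChar.norm_apply, one_mul, ← hcard]
    calc ‖∑ j ∈ A, T (y + (j : ZMod L))‖ ^ 2 ≤ (∑ j ∈ A, ‖T (y + (j : ZMod L))‖) ^ 2 := by
          gcongr
          exact norm_sum_le _ _
      _ ≤ _ := sq_sum_le_card_mul_sum_sq
  have hfib : ∑ i ∈ X, ∑ j ∈ A, ‖T (x i + (j : ZMod L))‖ ^ 2 ≤ K * ∑ y, ‖T y‖ ^ 2 := by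
    rw [← Finset.sum_product', ← Finset.sum_fiberwise (X ×ˢ A) (fun p => x p.1 + (p.2 : ZMod L)),
      Finset.mul_sum]
    refine Finset.sum_le_sum fun y _ => ?_
    rw [Finset.sum_congr rfl fun p hp => by rw [(Finset.mem_filter.mp hp).2], Finset.sum_const,
      nsmul_eq_mul]
    gcongr
    exact hK y
  have hinj : Set.InjOn (fun n : ℤ => ((n - M : ℤ) : ZMod L)) I := by
    intro n hn n' hn' h
    simp only [hI, Finset.coe_Icc, Set.mem_Icc] at hn hn'
    have h := (ZMod.intCast_eq_intCast_iff_dvd_sub _ _ _).mp h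
    have hLN : (N : ℤ) ≤ L := by
      rw [hL]
      push_cast
      nlinarith
    have := Int.eq_zero_of_abs_lt_dvd h (by rw [abs_lt]; omega)
    omega
  have hpars : ∑ y, ‖T y‖ ^ 2 = L * ∑ n ∈ I, ‖b n‖ ^ 2 :=
    sum_norm_sq_sum_stdAddChar I _ hinj b
  have hbn : ∑ n ∈ I, ‖b n‖ ^ 2 ≤ 4 / (2 * J + 1) ^ 2 * ∑ n ∈ I, ‖a n‖ ^ 2 := by
    rw [Finset.mul_sum]
    refine Finset.sum_le_sum fun n hn => ?_
    rw [hb, norm_div, div_pow, div_mul_eq_mul_div, mul_comm 4, mul_div_assoc, div_eq_mul_inv]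
    gcongr
    rw [inv_le_comm₀ (pow_pos (hJ1.trans_le (hgn n hn)) 2) (by positivity), inv_div]
    calc ((2 * J + 1 : ℝ)) ^ 2 / 4 = ((2 * J + 1 : ℝ) / 2) ^ 2 := by ring
      _ ≤ _ := by
        gcongr
        exact hgn n hn
  calc ∑ i ∈ X, ‖∑ n ∈ I, a n * stdAddChar ((n : ZMod L) * x i)‖ ^ 2
      ≤ ∑ i ∈ X, (2 * J + 1) * ∑ j ∈ A, ‖T (x i + (j : ZMod L))‖ ^ 2 :=
        Finset.sum_le_sum fun i _ => hpt _
    _ ≤ (2 * J + 1) * (K * (L * (4 / (2 * J + 1) ^ 2 * ∑ n ∈ I, ‖a n‖ ^ 2))) := by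
        rw [← Finset.mul_sum]
        gcongr
        refine hfib.trans ?_
        rw [hpars]
        gcongr
    _ = (24 * J / (2 * J + 1)) * (K * N * ∑ n ∈ I, ‖a n‖ ^ 2) := by
        rw [hL]
        push_cast
        field_simp
        ring
    _ ≤ 12 * (K * N * ∑ n ∈ I, ‖a n‖ ^ 2) := by
        gcongr
        rw [div_le_iff₀ (by positivity)]
        linarith
    _ = _ := by ring

/-! ### Iterated differences of polynomials -/

/-- `HasConstIterDiff j c f` says that the `j`-fold difference of `f` with increments `h₁, …, h_j`
is the constant `c * h₁ * ⋯ * h_j`. -/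
def HasConstIterDiff : ℕ → ℤ → (ℤ → ℤ) → Prop
  | 0, c, f => ∀ x, f x = c
  | j + 1, c, f => ∀ h, HasConstIterDiff j (c * h) fun x => f (x + h) - f x

namespace HasConstIterDiff

theorem add {j : ℕ} : ∀ {c d : ℤ} {f g : ℤ → ℤ}, HasConstIterDiff j c f → HasConstIterDiff j d g →
    HasConstIterDiff j (c + d) fun x => f x + g x := by
  induction j with
  | zero => intro c d f g hf hg x; simp only [hf x, hg x]
  | succ j ih =>
    intro c d f g hf hg h
    rw [add_mul]
    convert ih (hf h) (hg h) using 2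
    ring

theorem const_mul {j : ℕ} (e : ℤ) : ∀ {c : ℤ} {f : ℤ → ℤ}, HasConstIterDiff j c f →
    HasConstIterDiff j (e * c) fun x => e * f x := by
  induction j with
  | zero => intro c f hf x; simp only [hf x]
  | succ j ih =>
    intro c f hf h
    rw [mul_assoc]
    convert ih (hf h) using 2
    ring

theorem comp_add {j : ℕ} (e : ℤ) : ∀ {c : ℤ} {f : ℤ → ℤ}, HasConstIterDiff j c f →
    HasConstIterDiff j c fun x => f (x + e) := by
  induction j with
  | zero => intro c f hf x; simp only [hf (x + e)]
  | succ j ih =>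
    intro c f hf h
    convert ih (hf h) using 3
    ring_nf

/-- Leibniz rule: the difference of `x * f x` is `x * (f (x + h) - f x) + h * f (x + h)`. Induction
handles the first part, and the second adds one more copy of the constant; this is the source of
`k!`. -/
theorem id_mul {j : ℕ} : ∀ {c : ℤ} {f : ℤ → ℤ}, HasConstIterDiff j c f →
    HasConstIterDiff (j + 1) ((j + 1) * c) fun x => x * f x := by
  induction j with
  | zero =>
    intro c f hf h x
    simp only [hf x, hf (x + h)]
    push_cast
    ring
  | succ j ih =>
    intro c f hf h
    have h1 := (ih (hf h)).add ((hf.comp_add h).const_mul h)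
    convert h1 using 2
    · push_cast
      ring
    · ring

theorem pow (k : ℕ) : HasConstIterDiff k k.factorial fun x => x ^ k := by
  induction k with
  | zero => intro x; simp
  | succ k ih =>
    have := ih.id_mul
    rw [Nat.factorial_succ]
    push_cast
    simpa only [pow_succ'] using this

end HasConstIterDiff

/-! ### Weyl differencing on sets of integers -/

/-- The nonzero integers of absolute value less than `P`. -/
noncomputable def nonzeroLT (P : ℕ) : Finset ℤ := (Finset.Ioo (-(P : ℤ)) P).erase 0

theorem card_nonzeroLT_le (P : ℕ) : (nonzeroLT P).card ≤ 2 * P := by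
  rw [nonzeroLT]
  refine (Finset.card_erase_le).trans ?_
  rw [Int.card_Ioo]
  omega

/-- The sum of `g (h₁ * ⋯ * h_j)` over nonzero integers `h₁, …, h_j` of absolute value less than
`P`. -/
noncomputable def boxSum (P : ℕ) : ℕ → (ℤ → ℝ) → ℝ
  | 0, g => g 1
  | j + 1, g => ∑ h ∈ nonzeroLT P, boxSum P j fun n => g (h * n)

theorem boxSum_nonneg (P j : ℕ) : ∀ g : ℤ → ℝ, (∀ n, 0 ≤ g n) → 0 ≤ boxSum P j g := by
  induction j with
  | zero => exact fun g hg => hg 1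
  | succ j ih => exact fun g hg => Finset.sum_nonneg fun h _ => ih _ fun n => hg _

open Classical in
/-- The indicator function of the integers whose distance to the nearest multiple of `r` is at
most `E`. -/
noncomputable def nearMultiple (r E n : ℤ) : ℝ := if ∃ t : ℤ, |n - r * t| ≤ E then 1 else 0

theorem nearMultiple_nonneg (r E n : ℤ) : 0 ≤ nearMultiple r E n := by
  unfold nearMultiple
  split_ifs <;> norm_num

/-- Sort the pairs in `A × A` by their difference `h`. The diagonal contributes at most `P`, and all
other differences satisfy `0 < |h| < P`. -/
theorem card_sq_le_add_sum_card_inter (P : ℕ) (X : ℤ) (A : Finset ℤ)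
    (hA : A ⊆ Finset.Ico X (X + P)) :
    (A.card : ℝ) ^ 2 ≤ P + ∑ h ∈ nonzeroLT P, ((A.filter fun x => x + h ∈ A).card : ℝ) := by
  have hcard : A.card ≤ P := (Finset.card_le_card hA).trans (by simp)
  have hmaps : ∀ p ∈ A ×ˢ A, p.2 - p.1 ∈ insert 0 (nonzeroLT P) := by
    intro p hp
    rw [Finset.mem_product] at hp
    have h1 := Finset.mem_Ico.mp (hA hp.1)
    have h2 := Finset.mem_Ico.mp (hA hp.2)
    simp only [nonzeroLT, Finset.mem_insert, Finset.mem_erase, Finset.mem_Ioo]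
    omega
  have hfib : ∀ h : ℤ, ((A ×ˢ A).filter fun p => p.2 - p.1 = h).card
      ≤ (A.filter fun x => x + h ∈ A).card := by
    intro h
    refine Finset.card_le_card_of_injOn (fun p => p.1) ?_ ?_
    · intro p hp
      simp only [Finset.coe_filter, Finset.mem_product, Set.mem_ofPred_eq] at hp ⊢
      refine ⟨hp.1.1, ?_⟩
      rw [show p.1 + h = p.2 by omega]
      exact hp.1.2
    · intro p hp p' hp' hpp
      simp only [Finset.coe_filter, Finset.mem_product, Set.mem_ofPred_eq] at hp hp' hpp
      ext <;> omega
  have hsq := Finset.card_eq_sum_card_fiberwise hmaps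
  have h0 : (0 : ℤ) ∉ nonzeroLT P := by simp [nonzeroLT]
  rw [Finset.card_product, Finset.sum_insert h0] at hsq
  have hle : A.card * A.card
      ≤ P + ∑ h ∈ nonzeroLT P, (A.filter fun x => x + h ∈ A).card := by
    rw [hsq]
    gcongr with h _
    · exact ((hfib 0).trans (Finset.card_filter_le _ _)).trans hcard
    · exact hfib h
  rw [sq]
  exact_mod_cast hle

/-- Base case of the differencing: subtracting a fixed `x₀ ∈ A` makes `c (x - x₀)` close to a
multiple of `r`, with twice the tolerance. The `1` accounts for `x₀` itself. -/
theorem card_le_of_iterDiff_one {P : ℕ} {r E d c X : ℤ} {f : ℤ → ℤ} {A : Finset ℤ}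
    (hf : HasConstIterDiff 1 c f) (hA : A ⊆ Finset.Ico X (X + P)) (hd : 2 * d ≤ E)
    (hAf : ∀ x ∈ A, ∃ t : ℤ, |f x - r * t| ≤ d) :
    (A.card : ℝ) ≤ 1 + boxSum P 1 fun n => nearMultiple r E (c * n) := by
  classical
  rcases A.eq_empty_or_nonempty with rfl | ⟨x₀, hx₀⟩
  · simpa using add_nonneg zero_le_one (boxSum_nonneg P 1 _ fun n => nearMultiple_nonneg r E (c * n))
  have hbox : (boxSum P 1 fun n => nearMultiple r E (c * n))
      = (((nonzeroLT P).filter fun h => ∃ t : ℤ, |c * h - r * t| ≤ E).card : ℝ) := by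
    simp only [boxSum, nearMultiple, mul_one, Finset.sum_boole]
  rw [hbox]
  have hle : (A.erase x₀).card
      ≤ ((nonzeroLT P).filter fun h => ∃ t : ℤ, |c * h - r * t| ≤ E).card := by
    refine Finset.card_le_card_of_injOn (fun x => x - x₀) ?_ ?_
    · intro x hx
      obtain ⟨hne, hxA⟩ := Finset.mem_erase.mp hx
      have h1 := Finset.mem_Ico.mp (hA hxA)
      have h2 := Finset.mem_Ico.mp (hA hx₀)
      obtain ⟨t, ht⟩ := hAf x hxA
      obtain ⟨t₀, ht₀⟩ := hAf x₀ hx₀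
      simp only [Finset.coe_filter, nonzeroLT, Finset.mem_erase, Finset.mem_Ioo, Set.mem_ofPred_eq]
      refine ⟨by omega, t - t₀, ?_⟩
      have h3 : f x - f x₀ = c * (x - x₀) := by
        have := hf (x - x₀) x₀
        simpa using this
      rw [← h3, show f x - f x₀ - r * (t - t₀) = (f x - r * t) - (f x₀ - r * t₀) by ring]
      exact ((abs_sub _ _).trans (by linarith)).trans hd
    · intro x _ y _ hxy
      simpa using hxy
  have h1 := Finset.card_erase_add_one hx₀
  have h2 : ((A.erase x₀).card : ℝ) + 1 = A.card := by exact_mod_cast h1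
  have h3 : ((A.erase x₀).card : ℝ)
      ≤ ((nonzeroLT P).filter fun h => ∃ t : ℤ, |c * h - r * t| ≤ E).card := by exact_mod_cast hle
  linarith

theorem pow_sum_le_pow_mul_sum_pow {ι : Type*} {s : Finset ι} {f : ι → ℝ} {c : ℝ}
    (hf : ∀ i ∈ s, 0 ≤ f i) (hc : (s.card : ℝ) ≤ c) (m : ℕ) :
    (∑ i ∈ s, f i) ^ (m + 1) ≤ c ^ m * ∑ i ∈ s, f i ^ (m + 1) := by
  rcases s.eq_empty_or_nonempty with rfl | hne
  · simp
  have h1 := pow_sum_div_card_le_sum_pow hf m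
  have hpos : (0 : ℝ) < s.card := by exact_mod_cast hne.card_pos
  rw [div_le_iff₀ (by positivity), mul_comm] at h1
  exact h1.trans (mul_le_mul_of_nonneg_right (pow_le_pow_left₀ hpos.le hc m)
    (Finset.sum_nonneg fun i hi => pow_nonneg (hf i hi) _))

/-- The arithmetic of the induction step: raise the pair count `a ^ 2 ≤ P + S` to the power `κ`,
then insert the Hölder bound for `S` and the inductive bound summed over `h`. -/
theorem pow_mul_le_of_sq_le {κ m j : ℕ} (hm : κ = m + 1) {P C a S T V : ℝ} (hP : 1 ≤ P)
    (hC : 0 ≤ C) (hS : 0 ≤ S) (hT : 0 ≤ T) (hV : 0 ≤ V) (hsq : a ^ 2 ≤ P + S)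
    (hST : S ^ κ ≤ (2 * P) ^ m * T)
    (hTV : T * P ^ (j + 1) ≤ C * P ^ κ * (2 * P ^ (j + 1) + V)) :
    a ^ (2 * κ) * P ^ (j + 1 + 1)
      ≤ 2 ^ κ * (1 + 2 ^ κ * C * 2) * P ^ (2 * κ) * (P ^ (j + 1) + V) := by
  have h2 : (2 : ℝ) ^ m ≤ 2 ^ κ := pow_le_pow_right₀ (by norm_num) (by omega)
  have hpow : a ^ (2 * κ) ≤ 2 ^ κ * (P ^ κ + S ^ κ) := by
    calc a ^ (2 * κ) = (a ^ 2) ^ κ := by rw [← pow_mul]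
      _ ≤ (P + S) ^ κ := by gcongr
      _ ≤ 2 ^ m * (P ^ κ + S ^ κ) := by
          rw [hm]
          exact add_pow_le (by positivity) hS (m + 1)
      _ ≤ _ := by gcongr
  have hmP : (2 * P) ^ m * P ≤ 2 ^ κ * P ^ κ := by
    rw [mul_pow, mul_assoc, ← pow_succ, ← hm]
    gcongr
  have hPκ : P ≤ P ^ κ := le_self_pow₀ hP (by omega)
  calc a ^ (2 * κ) * P ^ (j + 1 + 1)
      ≤ 2 ^ κ * (P ^ κ + (2 * P) ^ m * T) * P ^ (j + 1 + 1) := by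
        gcongr
        exact hpow.trans (by gcongr)
    _ = 2 ^ κ * (P ^ κ * P * P ^ (j + 1) + ((2 * P) ^ m * P) * (T * P ^ (j + 1))) := by ring
    _ ≤ 2 ^ κ * (P ^ κ * P ^ κ * P ^ (j + 1)
          + (2 ^ κ * P ^ κ) * (C * P ^ κ * (2 * P ^ (j + 1) + V))) := by gcongr
    _ ≤ 2 ^ κ * (P ^ κ * P ^ κ * (P ^ (j + 1) + V)
          + (2 ^ κ * P ^ κ) * (C * P ^ κ * (2 * (P ^ (j + 1) + V)))) := by
        gcongr <;> linarith
    _ = _ := by ring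

/-- A combinatorial Weyl inequality: a bound for the number of integers in an interval of length
`P` at which a polynomial of degree `j + 1` is close to a multiple of `r`. -/
theorem exists_card_pow_mul_le (j : ℕ) : ∃ C : ℝ, 0 ≤ C ∧
    ∀ (P : ℕ) (r E d c X : ℤ) (f : ℤ → ℤ) (A : Finset ℤ), 1 ≤ P →
      HasConstIterDiff (j + 1) c f → A ⊆ Finset.Ico X (X + P) → 2 ^ (j + 1) * d ≤ E →
      (∀ x ∈ A, ∃ t : ℤ, |f x - r * t| ≤ d) →
      (A.card : ℝ) ^ 2 ^ j * (P : ℝ) ^ (j + 1)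
        ≤ C * (P : ℝ) ^ 2 ^ j *
          ((P : ℝ) ^ j + boxSum P (j + 1) fun n => nearMultiple r E (c * n)) := by
  induction j with
  | zero =>
    refine ⟨1, zero_le_one, fun P r E d c X f A hP hf hA hd hAf => ?_⟩
    have := card_le_of_iterDiff_one hf hA (by simpa using hd) hAf
    simp only [pow_zero, pow_one, zero_add, one_mul]
    rw [mul_comm]
    gcongr
  | succ j ih =>
    obtain ⟨C, hC, hind⟩ := ih
    refine ⟨2 ^ 2 ^ j * (1 + 2 ^ 2 ^ j * C * 2), by positivity,
      fun P r E d c X f A hP hf hA hd hAf => ?_⟩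
    set κ := 2 ^ j with hκ
    obtain ⟨m, hm⟩ : ∃ m, κ = m + 1 := ⟨κ - 1, by have : 0 < κ := by positivity
                                                  omega⟩
    have hP1 : (1 : ℝ) ≤ P := by exact_mod_cast hP
    set H := nonzeroLT P with hH
    set N : ℤ → ℝ := fun h => ((A.filter fun x => x + h ∈ A).card : ℝ) with hN
    set V : ℤ → ℝ := fun h => boxSum P (j + 1) fun n => nearMultiple r E (c * (h * n)) with hV
    have hVsum : (boxSum P (j + 1 + 1) fun n => nearMultiple r E (c * n)) = ∑ h ∈ H, V h := rfl
    have hstep : ∀ h, N h ^ κ * (P : ℝ) ^ (j + 1) ≤ C * (P : ℝ) ^ κ * ((P : ℝ) ^ j + V h) := by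
      intro h
      -- For `x` and `x + h` both in `A` the errors add, so the tolerance doubles in each round;
      -- hence the hypothesis `2 ^ (j + 1) * d ≤ E`.
      have := hind P r E (2 * d) (c * h) X (fun x => f (x + h) - f x)
        (A.filter fun x => x + h ∈ A) hP (hf h) ((Finset.filter_subset _ _).trans hA)
        (by rw [← mul_assoc, ← pow_succ]; exact hd) ?_
      · simpa only [mul_assoc c h] using this
      · intro x hx
        obtain ⟨hx1, hx2⟩ := Finset.mem_filter.mp hx
        obtain ⟨t, ht⟩ := hAf x hx1
        obtain ⟨s, hs⟩ := hAf _ hx2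
        refine ⟨s - t, ?_⟩
        rw [show f (x + h) - f x - r * (s - t) = (f (x + h) - r * s) - (f x - r * t) by ring]
        exact (abs_sub _ _).trans (by linarith)
    have hcardH : (H.card : ℝ) ≤ 2 * P := by exact_mod_cast card_nonzeroLT_le P
    have hNnn : ∀ h ∈ H, 0 ≤ N h := fun h _ => Nat.cast_nonneg _
    have hVnn : 0 ≤ ∑ h ∈ H, V h :=
      Finset.sum_nonneg fun h _ => boxSum_nonneg _ _ _ fun n => nearMultiple_nonneg _ _ _
    have hjensen : (∑ h ∈ H, N h) ^ κ ≤ (2 * P) ^ m * ∑ h ∈ H, N h ^ κ := by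
      rw [hm]
      exact pow_sum_le_pow_mul_sum_pow hNnn hcardH m
    have hsum : (∑ h ∈ H, N h ^ κ) * (P : ℝ) ^ (j + 1)
        ≤ C * (P : ℝ) ^ κ * (2 * (P : ℝ) ^ (j + 1) + ∑ h ∈ H, V h) := by
      rw [Finset.sum_mul]
      refine (Finset.sum_le_sum fun h _ => hstep h).trans ?_
      rw [← Finset.mul_sum, Finset.sum_add_distrib, Finset.sum_const, nsmul_eq_mul]
      have hle := mul_le_mul_of_nonneg_right hcardH (pow_nonneg (Nat.cast_nonneg P) j)
      refine mul_le_mul_of_nonneg_left ?_ (by positivity)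
      rw [pow_succ]
      linarith
    have hsq := card_sq_le_add_sum_card_inter P X A hA
    have hfin := pow_mul_le_of_sq_le hm hP1 hC (Finset.sum_nonneg hNnn)
      (Finset.sum_nonneg fun h hh => pow_nonneg (hNnn h hh) κ) hVnn hsq hjensen hsum
    rw [hVsum]
    simpa only [hκ, pow_succ'] using hfin

/-! ### Divisor bound and the count of products near multiples -/

/-- Grouping the terms of `boxSum` by the value of the product. -/
theorem boxSum_le {P k : ℕ} (hP : 1 ≤ P) {B : ℝ}
    (hB : ∀ n : ℤ, n ≠ 0 → |n| ≤ (P : ℤ) ^ k → (((nonzeroLT P).filter fun h => h ∣ n).card : ℝ) ≤ B) :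
    ∀ j ≤ k, ∀ g : ℤ → ℝ, (∀ n, 0 ≤ g n) →
      boxSum P j g ≤ B ^ j * ∑ n ∈ (Finset.Icc (-(P : ℤ) ^ j) ((P : ℤ) ^ j)).erase 0, g n := by
  have hPk : ∀ i, (1 : ℤ) ≤ (P : ℤ) ^ i := fun i => one_le_pow₀ (by exact_mod_cast hP)
  have hB0 : 0 ≤ B := (Nat.cast_nonneg _).trans (hB 1 one_ne_zero (by simpa using hPk k))
  intro j
  induction j with
  | zero =>
    intro _ g hg
    simp only [boxSum, pow_zero, one_mul]
    exact Finset.single_le_sum (f := g) (fun n _ => hg n) (by simp)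
  | succ j ih =>
    intro hj g hg
    set I := (Finset.Icc (-(P : ℤ) ^ j) ((P : ℤ) ^ j)).erase 0 with hI
    set I' := (Finset.Icc (-(P : ℤ) ^ (j + 1)) ((P : ℤ) ^ (j + 1))).erase 0 with hI'
    have hmem : ∀ p ∈ nonzeroLT P ×ˢ I, p.1 * p.2 ∈ I' := by
      intro p hp
      simp only [nonzeroLT, hI, Finset.mem_product, Finset.mem_erase, Finset.mem_Ioo,
        Finset.mem_Icc] at hp
      simp only [hI', Finset.mem_erase, Finset.mem_Icc]
      refine ⟨mul_ne_zero hp.1.1 hp.2.1, ?_⟩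
      rw [← abs_le, abs_mul, pow_succ']
      exact mul_le_mul (abs_lt.mpr hp.1.2).le (abs_le.mpr hp.2.2) (abs_nonneg _) (by positivity)
    calc boxSum P (j + 1) g = ∑ h ∈ nonzeroLT P, boxSum P j fun n => g (h * n) := rfl
      _ ≤ ∑ h ∈ nonzeroLT P, B ^ j * ∑ n ∈ I, g (h * n) :=
          Finset.sum_le_sum fun h _ => ih (by omega) _ fun n => hg _
      _ = B ^ j * ∑ p ∈ nonzeroLT P ×ˢ I, g (p.1 * p.2) := by
          rw [← Finset.mul_sum, Finset.sum_product]
      _ = B ^ j * ∑ n ∈ I', ∑ p ∈ (nonzeroLT P ×ˢ I).filter (fun p => p.1 * p.2 = n),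
            g (p.1 * p.2) := by rw [Finset.sum_fiberwise_of_maps_to hmem]
      _ ≤ B ^ j * ∑ n ∈ I', B * g n := by
          gcongr with n hn
          simp only [hI', Finset.mem_erase, Finset.mem_Icc] at hn
          rw [Finset.sum_congr rfl fun p hp => by rw [(Finset.mem_filter.mp hp).2],
            Finset.sum_const, nsmul_eq_mul]
          refine mul_le_mul_of_nonneg_right ?_ (hg n)
          have hn2 : |n| ≤ (P : ℤ) ^ k := (abs_le.mpr hn.2).trans
            (pow_le_pow_right₀ (by exact_mod_cast hP) hj)
          refine le_trans ?_ (hB n hn.1 hn2)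
          -- In a factorization of `n`, the first factor is a divisor of `n` and determines the
          -- second.
          refine Nat.cast_le.mpr (Finset.card_le_card_of_injOn (fun p => p.1) ?_ ?_)
          · intro p hp
            simp only [Finset.coe_filter, Finset.mem_product, Set.mem_ofPred_eq] at hp ⊢
            exact ⟨hp.1.1, p.2, hp.2.symm⟩
          · intro p hp p' hp' hpp
            simp only [Finset.coe_filter, Finset.mem_product, Set.mem_ofPred_eq] at hp hp' hpp
            have h0 : p.1 ≠ 0 := by
              have := hp.1.1
              rw [nonzeroLT, Finset.mem_erase] at this
              exact this.1
            refine Prod.ext hpp (mul_left_cancel₀ h0 ?_)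
            rw [hp.2, hpp, hp'.2]
      _ = _ := by
          rw [← Finset.mul_sum]
          ring

/-- The number of `n` with `|n| ≤ Y` for which `b * n` is close to a multiple of `r`. -/
theorem sum_nearMultiple_le {b r E Y F : ℤ} (hr : 0 < r) (hbr : IsCoprime b r) (hE : 0 ≤ E)
    (hF : 0 ≤ F) (hY : Y ≤ F * r) :
    ∑ n ∈ Finset.Icc (-Y) Y, nearMultiple r E (b * n) ≤ ((2 * E + 1) * (2 * F + 1) : ℤ) := by
  classical
  simp only [nearMultiple, Finset.sum_boole]
  have key : ((Finset.Icc (-Y) Y).filter fun n => ∃ t : ℤ, |b * n - r * t| ≤ E).card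
      ≤ (Finset.Icc (-E) E ×ˢ Finset.Icc (-F) F).card := by
    -- `T n` picks a nearby multiple. The residual `b n - r T n` fixes `n` modulo `r` by
    -- coprimality, and `n / r` then fixes `n`.
    set T : ℤ → ℤ := fun n => if h : ∃ t : ℤ, |b * n - r * t| ≤ E then h.choose else 0 with hT
    refine Finset.card_le_card_of_injOn (fun n => (b * n - r * T n, n / r)) ?_ ?_
    · intro n hn
      simp only [Finset.coe_filter, Finset.mem_Icc, Set.mem_ofPred_eq] at hn
      simp only [Finset.coe_product, Finset.coe_Icc, Set.mem_prod, Set.mem_Icc]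
      refine ⟨?_, ?_, ?_⟩
      · have := hn.2.choose_spec
        rw [← abs_le, hT]
        simpa only [hn.2, dif_pos] using this
      · rw [Int.le_ediv_iff_mul_le hr]
        linarith
      · exact Int.ediv_le_of_le_mul hr (hn.1.2.trans hY)
    · intro n _ n' _ h
      simp only [Prod.mk.injEq] at h
      have hdvd : r ∣ n - n' := by
        refine hbr.symm.dvd_of_dvd_mul_left ⟨T n - T n', ?_⟩
        linarith
      have h1 := Int.emod_add_mul_ediv n r
      have h2 := Int.emod_add_mul_ediv n' r
      have h3 : n % r = n' % r := Int.emod_eq_emod_iff_emod_sub_eq_zero.mpr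
        (Int.emod_eq_zero_of_dvd hdvd)
      rw [← h1, ← h2, h3, h.2]
  rw [Finset.card_product, Int.card_Icc, Int.card_Icc] at key
  have h1 : ((E + 1 - -E).toNat : ℤ) = 2 * E + 1 := by omega
  have h2 : ((F + 1 - -F).toNat : ℤ) = 2 * F + 1 := by omega
  rw [← h1, ← h2]
  exact_mod_cast key

/-- The divisor bound: `n` has `O(n ^ η)` divisors for every `η > 0`. -/
theorem exists_card_divisors_le_mul_rpow {η : ℝ} (hη : 0 < η) :
    ∃ C : ℝ, 1 ≤ C ∧ ∀ n : ℕ, n ≠ 0 → (n.divisors.card : ℝ) ≤ C * (n : ℝ) ^ η := by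
  have hl : 0 < η * Real.log 2 := mul_pos hη (Real.log_pos one_lt_two)
  -- Chosen so that `e + 1 ≤ K (1 + e η log 2) ≤ K p ^ (η e)`. Primes `p ≥ Y` have `p ^ η ≥ 2` and
  -- need no constant, so at most `Y` factors `K` occur.
  set K : ℝ := 1 + 1 / (η * Real.log 2) with hK
  have hK1 : 1 ≤ K := by
    have : 0 < 1 / (η * Real.log 2) := by positivity
    linarith
  obtain ⟨Y, hY⟩ := exists_nat_ge ((2 : ℝ) ^ (1 / η))
  refine ⟨K ^ Y, one_le_pow₀ hK1, fun n hn => ?_⟩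
  have hprime : ∀ p ∈ n.primeFactors, ((n.factorization p + 1 : ℕ) : ℝ)
      ≤ (if p < Y then K else 1) * ((p : ℝ) ^ n.factorization p) ^ η := by
    intro p hp
    have hp2 : (2 : ℝ) ≤ p := by exact_mod_cast (Nat.prime_of_mem_primeFactors hp).two_le
    set e := n.factorization p
    have hpe : ((p : ℝ) ^ e) ^ η = ((p : ℝ) ^ η) ^ e := by
      rw [← Real.rpow_natCast, ← Real.rpow_natCast, ← Real.rpow_mul (by positivity),
        ← Real.rpow_mul (by positivity), mul_comm]
    rw [hpe]
    push_cast
    split_ifs with hpY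
    · have h1 : 1 + η * Real.log 2 ≤ (p : ℝ) ^ η := by
        calc 1 + η * Real.log 2 ≤ Real.exp (η * Real.log 2) := by
              linarith [Real.add_one_le_exp (η * Real.log 2)]
          _ = (2 : ℝ) ^ η := by rw [Real.rpow_def_of_pos two_pos, mul_comm]
          _ ≤ _ := by gcongr
      have h2 : 1 + e * (η * Real.log 2) ≤ ((p : ℝ) ^ η) ^ e :=
        (one_add_mul_le_pow (by linarith) e).trans (by gcongr)
      calc (e : ℝ) + 1 ≤ K * (1 + e * (η * Real.log 2)) := by
            have h3 : K * (1 + e * (η * Real.log 2))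
                = 1 + e + 1 / (η * Real.log 2) + e * (η * Real.log 2) := by
              rw [hK]
              field_simp
              ring
            rw [h3]
            have : 0 < 1 / (η * Real.log 2) := by positivity
            have : 0 ≤ (e : ℝ) * (η * Real.log 2) := by positivity
            linarith
        _ ≤ _ := by gcongr
    · have h1 : (2 : ℝ) ≤ (p : ℝ) ^ η := by
        have hpY' : (2 : ℝ) ^ (1 / η) ≤ p := hY.trans (by exact_mod_cast not_lt.mp hpY)
        calc (2 : ℝ) = ((2 : ℝ) ^ (1 / η)) ^ η := by
              rw [← Real.rpow_mul two_pos.le, one_div_mul_cancel hη.ne', Real.rpow_one]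
          _ ≤ _ := by gcongr
      rw [one_mul]
      calc (e : ℝ) + 1 ≤ 2 ^ e := by exact_mod_cast Nat.lt_two_pow_self
        _ ≤ _ := by gcongr
  have hconst : ∏ p ∈ n.primeFactors, (if p < Y then K else 1) ≤ K ^ Y := by
    rw [Finset.prod_ite, Finset.prod_const_one, mul_one, Finset.prod_const]
    refine pow_le_pow_right₀ hK1 ?_
    calc _ ≤ (Finset.range Y).card := Finset.card_le_card fun p hp =>
          Finset.mem_range.mpr (Finset.mem_filter.mp hp).2
      _ = Y := Finset.card_range Y
  have hn' : (n : ℝ) = ∏ p ∈ n.primeFactors, (p : ℝ) ^ n.factorization p := by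
    conv_lhs => rw [← Nat.prod_factorization_pow_eq_self hn]
    rw [Finsupp.prod]
    push_cast
    rfl
  calc (n.divisors.card : ℝ) = ∏ p ∈ n.primeFactors, ((n.factorization p + 1 : ℕ) : ℝ) := by
        rw [Nat.card_divisors hn]
        push_cast
        rfl
    _ ≤ ∏ p ∈ n.primeFactors, ((if p < Y then K else 1) * ((p : ℝ) ^ n.factorization p) ^ η) :=
        Finset.prod_le_prod (fun _ _ => by positivity) hprime
    _ = (∏ p ∈ n.primeFactors, (if p < Y then K else 1)) * (n : ℝ) ^ η := by
        rw [Finset.prod_mul_distrib, Real.finsetProd_rpow _ _ (fun _ _ => by positivity), ← hn']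
    _ ≤ _ := by gcongr

theorem card_filter_dvd_nonzeroLT_le (P : ℕ) {n : ℤ} (hn : n ≠ 0) :
    ((nonzeroLT P).filter fun h => h ∣ n).card ≤ 2 * n.natAbs.divisors.card := by
  have : (2 * n.natAbs.divisors.card) = ((Finset.univ : Finset Bool) ×ˢ n.natAbs.divisors).card := by
    rw [Finset.card_product, Finset.card_univ, Fintype.card_bool]
  rw [this]
  refine Finset.card_le_card_of_injOn (fun h => (decide (0 < h), h.natAbs)) ?_ ?_
  · intro h hh
    simp only [Finset.coe_filter, Set.mem_ofPred_eq] at hh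
    simp only [Finset.coe_product, Set.mem_prod, Finset.mem_coe, Finset.mem_univ, true_and]
    exact Nat.mem_divisors.mpr ⟨Int.natAbs_dvd_natAbs.mpr hh.2, Int.natAbs_ne_zero.mpr hn⟩
  · intro h _ h' _ hhh
    simp only [Prod.mk.injEq, decide_eq_decide] at hhh
    omega

/-- The number of solutions of the inequality arising from Weyl differencing the monomial
`b * x ^ k` modulo `r`. -/
theorem exists_boxSum_nearMultiple_le (k : ℕ) {ε : ℝ} (hε : 0 < ε) :
    ∃ C : ℝ, 0 ≤ C ∧ ∀ (P : ℕ) (b r E : ℤ), 1 ≤ P → IsCoprime b r → (P : ℤ) ^ k ≤ r → 0 ≤ E →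
      (boxSum P k fun n => nearMultiple r E (b * k.factorial * n))
        ≤ C * (P : ℝ) ^ ε * (2 * E + 1) := by
  -- The divisor bound is used `k` times for integers up to `P ^ k`, costing `P ^ (k * k * η)`; the
  -- `+ 1` covers `k = 0`.
  have hη : 0 < ε / ((k : ℝ) * k + 1) := by positivity
  set η := ε / ((k : ℝ) * k + 1) with hηd
  obtain ⟨C, hC, hdiv⟩ := exists_card_divisors_le_mul_rpow hη
  refine ⟨(2 * C) ^ k * (2 * k.factorial + 1), by positivity, fun P b r E hP hbr hr hE => ?_⟩
  have hP1 : (1 : ℝ) ≤ P := by exact_mod_cast hP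
  have hPk : (1 : ℤ) ≤ (P : ℤ) ^ k := one_le_pow₀ (by exact_mod_cast hP)
  have hB : ∀ n : ℤ, n ≠ 0 → |n| ≤ (P : ℤ) ^ k →
      (((nonzeroLT P).filter fun h => h ∣ n).card : ℝ) ≤ 2 * C * ((P : ℝ) ^ k) ^ η := by
    intro n hn hnP
    have h1 : (((nonzeroLT P).filter fun h => h ∣ n).card : ℝ) ≤ 2 * n.natAbs.divisors.card := by
      exact_mod_cast card_filter_dvd_nonzeroLT_le P hn
    have h2 := hdiv n.natAbs (Int.natAbs_ne_zero.mpr hn)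
    have h3 : (n.natAbs : ℝ) ≤ (P : ℝ) ^ k := by
      rw [Nat.cast_natAbs]
      exact_mod_cast hnP
    have h4 : (n.natAbs : ℝ) ^ η ≤ ((P : ℝ) ^ k) ^ η := by gcongr
    nlinarith
  have hbox := boxSum_le hP hB k le_rfl (fun n => nearMultiple r E (b * k.factorial * n))
    fun n => nearMultiple_nonneg _ _ _
  have hk0 : (0 : ℤ) < k.factorial := by exact_mod_cast k.factorial_pos
  have hsum : ∑ n ∈ (Finset.Icc (-(P : ℤ) ^ k) ((P : ℤ) ^ k)).erase 0,
      nearMultiple r E (b * k.factorial * n) ≤ (2 * E + 1) * (2 * k.factorial + 1) := by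
    -- Only `b` is known to be coprime to `r`, so `k!` is absorbed into the variable: `n ↦ k! n`
    -- embeds the range into `|m| ≤ k! P ^ k ≤ k! r`.
    have h1 := sum_nearMultiple_le (Y := k.factorial * (P : ℤ) ^ k) (F := k.factorial)
      (by linarith) hbr hE hk0.le (by gcongr)
    push_cast at h1
    refine le_trans ?_ h1
    rw [← Finset.sum_image (s := (Finset.Icc (-(P : ℤ) ^ k) ((P : ℤ) ^ k)).erase 0)
      (g := fun n : ℤ => (k.factorial : ℤ) * n) (f := fun n => nearMultiple r E (b * n))
      (fun x _ y _ hxy => mul_left_cancel₀ hk0.ne' hxy) |>.trans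
      (Finset.sum_congr rfl fun n _ => by rw [mul_assoc])]
    refine Finset.sum_le_sum_of_subset_of_nonneg ?_ fun n _ _ => nearMultiple_nonneg _ _ _
    intro m hm
    obtain ⟨n, hn, rfl⟩ := Finset.mem_image.mp hm
    simp only [Finset.mem_erase, Finset.mem_Icc] at hn ⊢
    constructor <;> nlinarith
  have hpow : (2 * C * ((P : ℝ) ^ k) ^ η) ^ k ≤ (2 * C) ^ k * (P : ℝ) ^ ε := by
    rw [mul_pow]
    gcongr
    rw [← Real.rpow_natCast, ← Real.rpow_natCast, ← Real.rpow_mul (by positivity),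
      ← Real.rpow_mul (by positivity)]
    refine Real.rpow_le_rpow_of_exponent_le hP1 ?_
    have : (k : ℝ) * η * k ≤ ε := by
      rw [hηd, mul_div_assoc', div_mul_eq_mul_div, div_le_iff₀ (by positivity)]
      nlinarith
    rwa [← mul_assoc]
  have hE' : (0 : ℝ) ≤ E := by exact_mod_cast hE
  have hsum0 := Finset.sum_nonneg fun n (_ : n ∈ (Finset.Icc (-(P : ℤ) ^ k) ((P : ℤ) ^ k)).erase 0) =>
    nearMultiple_nonneg r E (b * k.factorial * n)
  calc (boxSum P k fun n => nearMultiple r E (b * k.factorial * n))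
      ≤ (2 * C) ^ k * (P : ℝ) ^ ε * ((2 * E + 1) * (2 * k.factorial + 1)) := by
        refine hbox.trans ?_
        gcongr
    _ = _ := by ring

/-! ### Counting fractions with power denominators near a point -/

theorem card_int_le_two_mul_add_one {s : Finset ℤ} {β w : ℝ} (hw : 0 ≤ w)
    (hs : ∀ a ∈ s, |β - a| ≤ w) : (s.card : ℝ) ≤ 2 * w + 1 := by
  have hsub : s ⊆ Finset.Icc ⌈β - w⌉ ⌊β + w⌋ := by
    intro a ha
    have := abs_le.mp (hs a ha)
    rw [Finset.mem_Icc, Int.ceil_le, Int.le_floor]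
    constructor <;> linarith
  have h1 := Finset.card_le_card hsub
  rw [Int.card_Icc] at h1
  have h2 : (s.card : ℝ) ≤ ((⌊β + w⌋ + 1 - ⌈β - w⌉).toNat : ℝ) := by exact_mod_cast h1
  have h3 : (((⌊β + w⌋ + 1 - ⌈β - w⌉).toNat : ℤ) : ℝ) ≤ 2 * w + 1 := by
    rw [Int.toNat_eq_max, Int.cast_max]
    refine max_le ?_ (by push_cast; linarith)
    push_cast
    linarith [Int.floor_le (β + w), Int.le_ceil (β - w)]
  exact h2.trans (by exact_mod_cast h3)

/-- For each `q` the numerators lie in an interval of length at most `(2P) ^ k / (3N)`; since `N ≤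
(2P) ^ k`, the extra `1` in the count is absorbed. -/
theorem mul_card_fractions_le_of_le {k P N : ℕ} (hN : 1 ≤ N) (hNP : N ≤ (2 * P) ^ k) {α : ℝ}
    {T : Finset (ℕ × ℤ)}
    (hT : ∀ p ∈ T, P ≤ p.1 ∧ p.1 < 2 * P ∧ |α - p.2 / (p.1 : ℝ) ^ k| ≤ 1 / (6 * N)) :
    (N : ℝ) * T.card ≤ 2 ^ (k + 1) * (P : ℝ) ^ (k + 1) := by
  have hN0 : (0 : ℝ) < N := by exact_mod_cast hN
  have hNP' : (N : ℝ) ≤ (2 * P : ℝ) ^ k := by exact_mod_cast hNP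
  have hfib : ∀ q ∈ Finset.Ico P (2 * P), ((T.filter fun p => p.1 = q).card : ℝ)
      ≤ 2 * (2 * P : ℝ) ^ k / N := by
    intro q hq
    have hq2 : (q : ℝ) ≤ 2 * P := by exact_mod_cast (Finset.mem_Ico.mp hq).2.le
    have hinj : ((T.filter fun p => p.1 = q).image fun p => p.2).card
        = (T.filter fun p => p.1 = q).card := by
      refine Finset.card_image_of_injOn ?_
      intro p hp p' hp' h
      simp only [Finset.coe_filter, Set.mem_ofPred_eq] at hp hp'
      exact Prod.ext (hp.2.trans hp'.2.symm) h
    rw [← hinj]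
    have h1 : (((T.filter fun p => p.1 = q).image fun p => p.2).card : ℝ)
        ≤ 2 * ((q : ℝ) ^ k / (6 * N)) + 1 := by
      refine card_int_le_two_mul_add_one (β := α * (q : ℝ) ^ k) (by positivity) fun a ha => ?_
      obtain ⟨p, hp, rfl⟩ := Finset.mem_image.mp ha
      obtain ⟨hpT, rfl⟩ := Finset.mem_filter.mp hp
      obtain ⟨h1, h2, h3⟩ := hT p hpT
      have hq0 : (0 : ℝ) < (p.1 : ℝ) ^ k := by
        have : 0 < p.1 := by omega
        positivity
      have h4 : α * (p.1 : ℝ) ^ k - p.2 = (α - p.2 / (p.1 : ℝ) ^ k) * (p.1 : ℝ) ^ k := by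
        field_simp
      rw [h4, abs_mul, abs_of_pos hq0]
      calc _ ≤ 1 / (6 * N) * (p.1 : ℝ) ^ k := by gcongr
        _ = _ := by ring
    refine h1.trans ?_
    have h2 : (q : ℝ) ^ k ≤ (2 * P : ℝ) ^ k := by gcongr
    have h3 : 2 * ((q : ℝ) ^ k / (6 * N)) ≤ 2 * ((2 * P : ℝ) ^ k / (6 * N)) := by gcongr
    have h4 : 1 ≤ (2 * P : ℝ) ^ k / N := by rwa [one_le_div hN0]
    have h5 : 2 * ((2 * P : ℝ) ^ k / (6 * N)) = (2 * P : ℝ) ^ k / N / 3 := by ring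
    have h6 : 2 * (2 * P : ℝ) ^ k / N = 2 * ((2 * P : ℝ) ^ k / N) := by ring
    linarith
  have hcard := Finset.card_eq_sum_card_fiberwise (f := fun p : ℕ × ℤ => p.1) (s := T)
    (t := Finset.Ico P (2 * P)) fun p hp => Finset.mem_Ico.mpr ⟨(hT p hp).1, (hT p hp).2.1⟩
  have h1 : (T.card : ℝ) ≤ P * (2 * (2 * P : ℝ) ^ k / N) := by
    rw [hcard]
    push_cast
    refine (Finset.sum_le_sum hfib).trans ?_
    rw [Finset.sum_const, nsmul_eq_mul, Nat.card_Ico, show 2 * P - P = P by omega]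
  calc (N : ℝ) * T.card ≤ N * (P * (2 * (2 * P : ℝ) ^ k / N)) := by gcongr
    _ = _ := by
      field_simp
      ring

/-- Cross-multiplying with one fixed fraction `b / q₀ ^ k` of `T` turns the count into that of `q`
for which `b q ^ k` is close to a multiple of `q₀ ^ k`, to which the Weyl inequality applies. -/
theorem exists_card_fractions_pow_le (j : ℕ) {ε : ℝ} (hε : 0 < ε) :
    ∃ C : ℝ, 1 ≤ C ∧ ∀ (P N : ℕ) (α : ℝ) (T : Finset (ℕ × ℤ)), 1 ≤ P → (2 * P) ^ (j + 1) < N →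
      (∀ p ∈ T, P ≤ p.1 ∧ p.1 < 2 * P ∧ IsCoprime p.2 (p.1 : ℤ) ∧
        |α - p.2 / (p.1 : ℝ) ^ (j + 1)| ≤ 1 / (6 * N)) →
      (T.card : ℝ) ^ 2 ^ j * (P : ℝ) ^ (j + 1)
        ≤ C * (P : ℝ) ^ ε * (P : ℝ) ^ 2 ^ j
          * ((P : ℝ) ^ j + (P : ℝ) ^ (2 * (j + 1)) / N) := by
  obtain ⟨C₁, hC₁, hweyl⟩ := exists_card_pow_mul_le j
  obtain ⟨C₂, hC₂, hbox⟩ := exists_boxSum_nearMultiple_le (j + 1) hε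
  set k := j + 1 with hk
  refine ⟨1 + C₁ * (1 + C₂ * (2 * 2 ^ k * 2 ^ (2 * k) + 1)),
    by have : 0 ≤ C₁ * (1 + C₂ * (2 * 2 ^ k * 2 ^ (2 * k) + 1)) := by positivity
       linarith, fun P N α T hP hN hT => ?_⟩
  have hP1 : (1 : ℝ) ≤ P := by exact_mod_cast hP
  have hN0 : (0 : ℝ) < N := by exact_mod_cast (Nat.zero_le _).trans_lt hN
  rcases T.eq_empty_or_nonempty with rfl | ⟨p₀, hp₀⟩
  · rw [Finset.card_empty, Nat.cast_zero, zero_pow (by positivity), zero_mul]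
    positivity
  obtain ⟨hq₀, hq₀', hcop, hα₀⟩ := hT p₀ hp₀
  set q₀ := p₀.1
  set b := p₀.2
  have hq₀P : (P : ℤ) ^ k ≤ (q₀ : ℤ) ^ k := by gcongr
  -- Rounding down loses nothing, since the cross differences are integers.
  set D : ℕ := (2 * P) ^ (2 * k) / N with hD
  have hpos : ∀ p ∈ T, (0 : ℝ) < p.1 := fun p hp => by
    have := (hT p hp).1
    exact_mod_cast (by omega : 0 < p.1)
  have hlt : ∀ p ∈ T, (p.1 : ℝ) ^ k ≤ (2 * P) ^ k := fun p hp => by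
    have : (p.1 : ℝ) ≤ 2 * P := by exact_mod_cast (hT p hp).2.1.le
    have := hpos p hp
    gcongr
  have hcross : ∀ p ∈ T, ∀ p' ∈ T,
      |(p'.2 : ℝ) * (p.1 : ℝ) ^ k - (p'.1 : ℝ) ^ k * p.2|
        ≤ (p.1 : ℝ) ^ k * (p'.1 : ℝ) ^ k / (3 * N) := by
    intro p hp p' hp'
    have h1 := hpos p hp
    have h2 := hpos p' hp'
    have h3 : (p'.2 : ℝ) * (p.1 : ℝ) ^ k - (p'.1 : ℝ) ^ k * p.2
        = (p.1 : ℝ) ^ k * (p'.1 : ℝ) ^ k *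
          ((α - p.2 / (p.1 : ℝ) ^ k) - (α - p'.2 / (p'.1 : ℝ) ^ k)) := by
      field_simp
      ring
    rw [h3, abs_mul, abs_of_pos (by positivity), div_eq_mul_inv (_ * _)]
    gcongr
    refine (abs_sub _ _).trans ((add_le_add (hT p hp).2.2.2 (hT p' hp').2.2.2).trans_eq ?_)
    field_simp
    norm_num
  -- Two numerators over the same `q` differ by at most `q ^ k / (3N) < 1`, because `N > (2P) ^ k`.
  have hinj : Set.InjOn (fun p : ℕ × ℤ => (p.1 : ℤ)) T := by
    intro p hp p' hp' h
    have hpp : p.1 = p'.1 := Nat.cast_injective (R := ℤ) h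
    refine Prod.ext hpp ?_
    have h1 := hcross p hp p' hp'
    have h2 := hpos p hp
    rw [← hpp, mul_comm, ← mul_sub, abs_mul, abs_of_pos (by positivity), mul_div_assoc] at h1
    have h3 := le_of_mul_le_mul_left h1 (by positivity)
    have h4 : (p.1 : ℝ) ^ k / (3 * N) < 1 := by
      rw [div_lt_one (by positivity)]
      have : ((2 * P : ℝ)) ^ k < N := by exact_mod_cast hN
      linarith [hlt p hp]
    have h5 : |p'.2 - p.2| < 1 := by exact_mod_cast h3.trans_lt h4
    rw [Int.abs_lt_one_iff] at h5
    omega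
  set A := T.image fun p => (p.1 : ℤ) with hA
  have hAcard : A.card = T.card := Finset.card_image_of_injOn hinj
  have hpoly : HasConstIterDiff k (b * k.factorial) fun x => b * x ^ k :=
    (HasConstIterDiff.pow k).const_mul b
  have hw := hweyl P ((q₀ : ℤ) ^ k) (2 ^ k * D) D (b * k.factorial) P _ A hP hpoly ?_ le_rfl ?_
  rotate_left
  · intro x hx
    obtain ⟨p, hp, rfl⟩ := Finset.mem_image.mp hx
    have := hT p hp
    rw [Finset.mem_Ico]
    omega
  · intro x hx
    obtain ⟨p, hp, rfl⟩ := Finset.mem_image.mp hx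
    refine ⟨p.2, ?_⟩
    have h1 := hcross p hp p₀ hp₀
    have h2 : (p.1 : ℝ) ^ k * (q₀ : ℝ) ^ k / (3 * N) ≤ (2 * P) ^ (2 * k) / N := by
      rw [two_mul k, pow_add (2 * (P : ℝ)) k k, div_le_div_iff₀ (by positivity) hN0]
      have h3 := mul_le_mul (hlt p hp) (hlt p₀ hp₀) (by positivity) (by positivity)
      have h4 : (0 : ℝ) ≤ (2 * P) ^ k * (2 * P) ^ k := by positivity
      nlinarith
    have h3 : ((|b * (p.1 : ℤ) ^ k - (q₀ : ℤ) ^ k * p.2|.toNat : ℤ))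
        = |b * (p.1 : ℤ) ^ k - (q₀ : ℤ) ^ k * p.2| := Int.toNat_of_nonneg (abs_nonneg _)
    rw [← h3]
    norm_cast
    rw [hD, Nat.le_div_iff_mul_le (by exact_mod_cast hN0)]
    have h4 := h1.trans h2
    rw [le_div_iff₀ hN0] at h4
    have h5 : |b * (p.1 : ℤ) ^ k - (q₀ : ℤ) ^ k * p.2| * N ≤ (2 * P) ^ (2 * k) := by
      exact_mod_cast h4
    rw [← h3] at h5
    exact_mod_cast h5
  have hb := hbox P b ((q₀ : ℤ) ^ k) (2 ^ k * D) hP hcop.pow_right hq₀P (by positivity)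
  rw [hAcard] at hw
  have hDle : (D : ℝ) ≤ 2 ^ (2 * k) * ((P : ℝ) ^ (2 * k) / N) := by
    refine Nat.cast_div_le.trans_eq ?_
    push_cast
    rw [mul_pow, mul_div_assoc]
  have hPε : 1 ≤ (P : ℝ) ^ ε := Real.one_le_rpow hP1 hε.le
  have hPj : 1 ≤ (P : ℝ) ^ j := one_le_pow₀ hP1
  set Z : ℝ := (P : ℝ) ^ (2 * k) / N with hZ
  have hZ0 : 0 ≤ Z := by positivity
  push_cast at hb
  calc (T.card : ℝ) ^ 2 ^ j * (P : ℝ) ^ k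
      ≤ C₁ * (P : ℝ) ^ 2 ^ j * ((P : ℝ) ^ j
          + C₂ * (P : ℝ) ^ ε * (2 * (2 ^ k * (2 ^ (2 * k) * Z)) + 1)) := by
        refine hw.trans ?_
        gcongr
        refine hb.trans ?_
        gcongr
    _ ≤ C₁ * (P : ℝ) ^ 2 ^ j * ((P : ℝ) ^ ε * ((P : ℝ) ^ j + Z)
          + C₂ * (P : ℝ) ^ ε * ((2 * 2 ^ k * 2 ^ (2 * k) + 1) * ((P : ℝ) ^ j + Z))) := by
        gcongr
        · calc (P : ℝ) ^ j ≤ 1 * ((P : ℝ) ^ j + Z) := by linarith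
            _ ≤ _ := by gcongr
        · have h1 : (0 : ℝ) ≤ 2 * 2 ^ k * 2 ^ (2 * k) * (P : ℝ) ^ j := by positivity
          linarith
    _ = C₁ * (1 + C₂ * (2 * 2 ^ k * 2 ^ (2 * k) + 1)) * ((P : ℝ) ^ ε * (P : ℝ) ^ 2 ^ j
          * ((P : ℝ) ^ j + Z)) := by ring
    _ ≤ (1 + C₁ * (1 + C₂ * (2 * 2 ^ k * 2 ^ (2 * k) + 1))) * ((P : ℝ) ^ ε * (P : ℝ) ^ 2 ^ j
          * ((P : ℝ) ^ j + Z)) := by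
        gcongr
        linarith
    _ = _ := by ring

/-- The number of fractions `a / q ^ k` in lowest terms, with `q` in a dyadic interval, that lie in
an interval of length `1 / (3 * N)`. -/
theorem exists_mul_card_fractions_le (j : ℕ) {κ : ℝ} (hκ : κ = 2 ^ j) {ε : ℝ} (hε : 0 < ε) :
    ∃ C : ℝ, 0 < C ∧ ∀ (P N : ℕ) (α : ℝ) (T : Finset (ℕ × ℤ)), 1 ≤ P → 1 ≤ N →
      (∀ p ∈ T, P ≤ p.1 ∧ p.1 < 2 * P ∧ IsCoprime p.2 (p.1 : ℤ) ∧
        |α - p.2 / (p.1 : ℝ) ^ (j + 1)| ≤ 1 / (6 * N)) →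
      (N : ℝ) * T.card ≤ C * ((P : ℝ) ^ (j + 1 + 1) + (N : ℝ) ^ ε *
        ((N : ℝ) * (P : ℝ) ^ ((κ - 1) / κ) +
          (N : ℝ) ^ (1 - 1 / κ) * (P : ℝ) ^ ((κ + (j + 1 : ℕ)) / κ))) := by
  obtain ⟨C, hC, hcard⟩ := exists_card_fractions_pow_le j hε
  refine ⟨2 ^ (j + 1 + 1) + 2 * C, by positivity, fun P N α T hP hN hT => ?_⟩
  have hP1 : (1 : ℝ) ≤ P := by exact_mod_cast hP
  have hP0 : (0 : ℝ) < P := by linarith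
  have hN1 : (1 : ℝ) ≤ N := by exact_mod_cast hN
  have hN0 : (0 : ℝ) < N := by linarith
  set W : ℝ := (N : ℝ) ^ ε * ((N : ℝ) * (P : ℝ) ^ ((κ - 1) / κ) +
    (N : ℝ) ^ (1 - 1 / κ) * (P : ℝ) ^ ((κ + (j + 1 : ℕ)) / κ)) with hW
  have hW0 : 0 ≤ W := by positivity
  rcases le_or_gt N ((2 * P) ^ (j + 1)) with hNP | hNP
  · have h1 := mul_card_fractions_le_of_le hN hNP (T := T)
      fun p hp => ⟨(hT p hp).1, (hT p hp).2.1, (hT p hp).2.2.2⟩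
    calc (N : ℝ) * T.card ≤ 2 ^ (j + 1 + 1) * (P : ℝ) ^ (j + 1 + 1) := h1
      _ ≤ (2 ^ (j + 1 + 1) + 2 * C) * ((P : ℝ) ^ (j + 1 + 1) + W) := by
        gcongr
        · linarith
        · linarith
  · have h1 := hcard P N α T hP hNP hT
    have hκ0 : 0 < κ := by rw [hκ]; positivity
    have hκn : ((2 ^ j : ℕ) : ℝ) = κ := by rw [hκ]; push_cast; rfl
    -- `X` and `Y` are the `κ`-th roots of `P ^ (κ - 1)` and `P ^ (κ + k) / N`, where `k = j + 1`,
    -- the two terms left after dividing the bound by `P ^ k`.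
    set X : ℝ := (P : ℝ) ^ ((κ - 1) / κ) with hX
    set Y : ℝ := (N : ℝ) ^ (-(1 / κ)) * (P : ℝ) ^ ((κ + (j + 1 : ℕ)) / κ) with hY
    have hXpow : X ^ 2 ^ j * P = (P : ℝ) ^ 2 ^ j := by
      rw [hX, ← Real.rpow_natCast, ← Real.rpow_mul hP0.le, hκn, div_mul_cancel₀ _ hκ0.ne',
        Real.rpow_sub_one hP0.ne', div_mul_cancel₀ _ hP0.ne', ← hκn, Real.rpow_natCast]
    have hYpow : Y ^ 2 ^ j = (P : ℝ) ^ 2 ^ j * (P : ℝ) ^ (j + 1) / N := by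
      rw [hY, mul_pow, ← Real.rpow_natCast, ← Real.rpow_mul hN0.le, ← Real.rpow_natCast,
        ← Real.rpow_mul hP0.le, hκn, div_mul_cancel₀ _ hκ0.ne', Real.rpow_add hP0, neg_mul,
        one_div_mul_cancel hκ0.ne', Real.rpow_neg_one, ← hκn, Real.rpow_natCast,
        Real.rpow_natCast]
      ring
    have hPN : (P : ℝ) ^ ε ≤ (N : ℝ) ^ ε := by
      refine Real.rpow_le_rpow hP0.le ?_ hε.le
      have : P ≤ (2 * P) ^ (j + 1) := (by omega : P ≤ 2 * P).trans (Nat.le_self_pow (by omega) _)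
      exact_mod_cast this.trans hNP.le
    have hX0 : 0 ≤ X := by positivity
    have hY0 : 0 ≤ Y := by positivity
    have hNε : 1 ≤ (N : ℝ) ^ ε := Real.one_le_rpow hN1 hε.le
    have h2 : (T.card : ℝ) ^ 2 ^ j ≤ (2 * C * (N : ℝ) ^ ε * (X + Y)) ^ 2 ^ j := by
      have hPj : (0 : ℝ) < (P : ℝ) ^ (j + 1) := by positivity
      refine le_of_mul_le_mul_right (h1.trans ?_) hPj
      calc C * (P : ℝ) ^ ε * (P : ℝ) ^ 2 ^ j * ((P : ℝ) ^ j + (P : ℝ) ^ (2 * (j + 1)) / N)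
          = C * (P : ℝ) ^ ε * (X ^ 2 ^ j + Y ^ 2 ^ j) * (P : ℝ) ^ (j + 1) := by
            have e1 : (P : ℝ) ^ 2 ^ j * (P : ℝ) ^ j = X ^ 2 ^ j * (P : ℝ) ^ (j + 1) := by
              rw [← hXpow]
              ring
            have e2 : (P : ℝ) ^ 2 ^ j * ((P : ℝ) ^ (2 * (j + 1)) / N)
                = Y ^ 2 ^ j * (P : ℝ) ^ (j + 1) := by
              rw [hYpow]
              ring
            linear_combination C * (P : ℝ) ^ ε * (e1 + e2)
        _ ≤ C * (N : ℝ) ^ ε * ((X + Y) ^ 2 ^ j + (X + Y) ^ 2 ^ j) * (P : ℝ) ^ (j + 1) := by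
            gcongr <;> linarith
        _ = (2 * C * (N : ℝ) ^ ε) * (X + Y) ^ 2 ^ j * (P : ℝ) ^ (j + 1) := by ring
        -- The factor `2 C N ^ ε` is at least `1`, so it may be raised to the power `κ` before the
        -- root is taken.
        _ ≤ (2 * C * (N : ℝ) ^ ε * (X + Y)) ^ 2 ^ j * (P : ℝ) ^ (j + 1) := by
            rw [mul_pow _ (X + Y)]
            gcongr
            refine le_self_pow₀ ?_ (by positivity)
            nlinarith
    have h3 : (T.card : ℝ) ≤ 2 * C * (N : ℝ) ^ ε * (X + Y) :=
      le_of_pow_le_pow_left₀ (by positivity) (by positivity) h2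
    have hNY : N * Y = (N : ℝ) ^ (1 - 1 / κ) * (P : ℝ) ^ ((κ + (j + 1 : ℕ)) / κ) := by
      rw [hY, ← mul_assoc, sub_eq_add_neg, Real.rpow_add hN0, Real.rpow_one]
    calc (N : ℝ) * T.card ≤ N * (2 * C * (N : ℝ) ^ ε * (X + Y)) := by gcongr
      _ = 2 * C * W := by
          rw [hW, ← hNY]
          ring
      _ ≤ (2 ^ (j + 1 + 1) + 2 * C) * ((P : ℝ) ^ (j + 1 + 1) + W) := by
        have h4 : (0 : ℝ) < 2 ^ (j + 1 + 1) := by positivity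
        have h5 : (0 : ℝ) < (P : ℝ) ^ (j + 1 + 1) := by positivity
        gcongr <;> linarith

/-! ### The large sieve for fractions with power denominators -/

open ZMod in
/-- The large sieve inequality for the fractions `c / q ^ k` in lowest terms, in terms of the number
of those fractions in short intervals. -/
theorem large_sieve_fractions {k N : ℕ} (hk : k ≠ 0) (hN : 0 < N) {S : Finset ℕ}
    (hS : ∀ q ∈ S, 0 < q) {K : ℝ}
    (hK : ∀ (α : ℝ) (T : Finset (ℕ × ℤ)), (∀ p ∈ T, p.1 ∈ S ∧ IsCoprime p.2 (p.1 : ℤ) ∧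
      |α - p.2 / (p.1 : ℝ) ^ k| ≤ 1 / (6 * N)) → (T.card : ℝ) ≤ K) (a : ℤ → ℂ) (M : ℤ) :
    ∑ q ∈ S, ∑ c ∈ Finset.range (q ^ k) with c.Coprime (q ^ k),
        ‖∑ n ∈ Finset.Icc (M + 1) (M + N),
          a n * Complex.exp (2 * Real.pi * Complex.I * (n * c) / (q ^ k : ℕ))‖ ^ 2
      ≤ 12 * K * N * ∑ n ∈ Finset.Icc (M + 1) (M + N), ‖a n‖ ^ 2 := by
  classical
  -- A common multiple of the denominators puts every `c / q ^ k` on the grid of step `1 / L`; a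
  -- window of `J` steps then has width `J / L = 1 / (6N)`.
  set J := ∏ q ∈ S, q ^ k with hJd
  have hJ : 0 < J := Finset.prod_pos fun q hq => pow_pos (hS q hq) k
  set L := 6 * N * J with hL
  have hL0 : 0 < L := by positivity
  have : NeZero L := ⟨hL0.ne'⟩
  have hdiv : ∀ q ∈ S, L / q ^ k * q ^ k = L := fun q hq =>
    Nat.div_mul_cancel ((Finset.dvd_prod_of_mem (fun q => q ^ k) hq).mul_left _)
  set R : ℕ → Finset ℕ := fun q => (Finset.range (q ^ k)).filter fun c => c.Coprime (q ^ k) with hR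
  set x : (Σ _ : ℕ, ℕ) → ZMod L := fun i => ((i.2 * (L / i.1 ^ k) : ℕ) : ZMod L) with hx
  have hchar : ∀ q ∈ S, ∀ (c : ℕ) (n : ℤ),
      Complex.exp (2 * Real.pi * Complex.I * (n * c) / (q ^ k : ℕ))
        = stdAddChar ((n : ZMod L) * x ⟨q, c⟩) := by
    intro q hq c n
    have h := stdAddChar_coe (N := L) (n * (c * (L / q ^ k : ℕ) : ℕ))
    rw [Int.cast_mul, Int.cast_natCast] at h
    simp only [hx]
    rw [h]
    congr 1
    have hq0 : ((q ^ k : ℕ) : ℂ) ≠ 0 := by exact_mod_cast (pow_pos (hS q hq) k).ne'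
    have hm0 : ((L / q ^ k : ℕ) : ℂ) ≠ 0 := by
      intro h0
      have h0' : L / q ^ k = 0 := by exact_mod_cast h0
      have := hdiv q hq
      rw [h0', zero_mul] at this
      exact hL0.ne this
    have hL' : (L : ℂ) = (L / q ^ k : ℕ) * (q ^ k : ℕ) := by exact_mod_cast (hdiv q hq).symm
    rw [hL', Int.cast_mul, Int.cast_natCast, Nat.cast_mul c]
    field_simp
  have hrw : ∑ q ∈ S, ∑ c ∈ R q, ‖∑ n ∈ Finset.Icc (M + 1) (M + N),
        a n * Complex.exp (2 * Real.pi * Complex.I * (n * c) / (q ^ k : ℕ))‖ ^ 2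
      = ∑ i ∈ S.sigma R, ‖∑ n ∈ Finset.Icc (M + 1) (M + N),
        a n * stdAddChar ((n : ZMod L) * x i)‖ ^ 2 := by
    rw [Finset.sum_sigma]
    refine Finset.sum_congr rfl fun q hq => Finset.sum_congr rfl fun c _ => ?_
    congr 2
    exact Finset.sum_congr rfl fun n _ => by rw [hchar q hq]
  rw [hrw]
  refine large_sieve_zmod hN hJ hL _ _ K (fun y => ?_) a M
  set F := ((S.sigma R) ×ˢ Finset.Icc (-(J : ℤ)) J).filter
    fun p => x p.1 + (p.2 : ZMod L) = y with hF
  -- Congruence modulo `L` is closeness modulo `1`. The second coordinate lifts `c` by a multiple of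
  -- `q ^ k`, giving a numerator whose fraction is genuinely close to `y.val / L`.
  set φ : (Σ _ : ℕ, ℕ) × ℤ → ℕ × ℤ :=
    fun p => (p.1.1, ((y.val : ℤ) - p.2) / (L / p.1.1 ^ k : ℕ)) with hφ
  have hspec : ∀ p ∈ F, p.1.1 ∈ S ∧ p.1.2 < p.1.1 ^ k ∧ p.1.2.Coprime (p.1.1 ^ k) ∧ |p.2| ≤ J ∧
      ∃ t : ℤ, (φ p).2 = p.1.2 + t * (p.1.1 : ℤ) ^ k ∧
        (y.val : ℤ) - p.2 = (φ p).2 * (L / p.1.1 ^ k : ℕ) := by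
    intro p hp
    simp only [hF, hR, Finset.mem_filter, Finset.mem_product, Finset.mem_sigma,
      Finset.mem_range, Finset.mem_Icc] at hp
    obtain ⟨⟨⟨hq, hc, hcop⟩, hj⟩, hy⟩ := hp
    refine ⟨hq, hc, hcop, abs_le.mpr hj, ?_⟩
    have h1 : ((p.1.2 * (L / p.1.1 ^ k : ℕ) + p.2 : ℤ) : ZMod L) = ((y.val : ℤ) : ZMod L) := by
      rw [Int.cast_natCast, ZMod.natCast_zmod_val, ← hy]
      simp only [hx]
      rw [Int.cast_add, Int.cast_mul, Int.cast_natCast, Int.cast_natCast, Nat.cast_mul]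
    obtain ⟨t, ht⟩ := (ZMod.intCast_eq_intCast_iff_dvd_sub _ _ _).mp h1
    have hLm : (L : ℤ) = (L / p.1.1 ^ k : ℕ) * (p.1.1 : ℤ) ^ k := by exact_mod_cast (hdiv _ hq).symm
    have hm0 : ((L / p.1.1 ^ k : ℕ) : ℤ) ≠ 0 := by
      intro h0
      rw [h0, zero_mul] at hLm
      exact hL0.ne' (by exact_mod_cast hLm)
    have h2 : (y.val : ℤ) - p.2 = (p.1.2 + t * (p.1.1 : ℤ) ^ k) * (L / p.1.1 ^ k : ℕ) := by
      rw [hLm] at ht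
      linear_combination ht
    have h3 : (φ p).2 = p.1.2 + t * (p.1.1 : ℤ) ^ k := by
      simp only [hφ]
      rw [h2, Int.mul_ediv_cancel _ hm0]
    exact ⟨t, h3, by rw [h3, h2]⟩
  have hinj : Set.InjOn φ F := by
    intro p hp p' hp' h
    obtain ⟨_, hc, _, _, t, ht, hy⟩ := hspec p hp
    obtain ⟨_, hc', _, _, t', ht', hy'⟩ := hspec p' hp'
    have hq : p.1.1 = p'.1.1 := congrArg Prod.fst h
    rw [h] at ht hy
    rw [← hq] at ht' hy' hc'
    have hj : p.2 = p'.2 := by linarith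
    have hcc : p.1.2 = p'.1.2 := by
      have hdvd : ((p.1.1 ^ k : ℕ) : ℤ) ∣ (p'.1.2 : ℤ) - p.1.2 := by
        refine ⟨t - t', ?_⟩
        push_cast
        linear_combination ht - ht'
      have := Int.eq_zero_of_abs_lt_dvd hdvd (by rw [abs_lt]; omega)
      omega
    exact Prod.ext (Sigma.ext hq (heq_of_eq hcc)) hj
  rw [← Finset.card_image_of_injOn hinj]
  refine hK ((y.val : ℝ) / L) _ fun p' hp' => ?_
  obtain ⟨p, hp, rfl⟩ := Finset.mem_image.mp hp'
  obtain ⟨hq, _, hcop, hj, t, ht, hy⟩ := hspec p hp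
  refine ⟨hq, ?_, ?_⟩
  · have h1 : IsCoprime (p.1.2 : ℤ) ((p.1.1 : ℤ) ^ k) := by
      exact_mod_cast Nat.isCoprime_iff_coprime.mpr hcop
    have h2 : IsCoprime ((p.1.2 : ℤ) + t * (p.1.1 : ℤ) ^ k) ((p.1.1 : ℤ) ^ k) :=
      h1.add_mul_right_left t
    rw [ht]
    exact (IsCoprime.pow_right_iff (Nat.pos_of_ne_zero hk)).mp h2
  · have hq0 : (0 : ℝ) < (p.1.1 : ℝ) ^ k := by
      have : (0 : ℝ) < p.1.1 := by exact_mod_cast hS _ hq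
      positivity
    have hL0' : (0 : ℝ) < L := by exact_mod_cast hL0
    have hLm : ((L / p.1.1 ^ k : ℕ) : ℝ) * (p.1.1 : ℝ) ^ k = L := by exact_mod_cast hdiv _ hq
    have hy' : (y.val : ℝ) - p.2 = (φ p).2 * (L / p.1.1 ^ k : ℕ) := by
      have := congrArg (Int.cast : ℤ → ℝ) hy
      rwa [Int.cast_sub, Int.cast_mul, Int.cast_natCast, Int.cast_natCast] at this
    have h1 : (y.val : ℝ) / L - (φ p).2 / (p.1.1 : ℝ) ^ k = p.2 / L := by
      rw [div_sub_div _ _ hL0'.ne' hq0.ne', div_eq_div_iff (by positivity) hL0'.ne']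
      linear_combination (L : ℝ) * (p.1.1 : ℝ) ^ k * hy' + (L : ℝ) * (φ p).2 * hLm
    have hj' : |(p.2 : ℝ)| ≤ J := by exact_mod_cast hj
    change |(y.val : ℝ) / L - (φ p).2 / (p.1.1 : ℝ) ^ k| ≤ _
    rw [h1, abs_div, abs_of_pos hL0', div_le_div_iff₀ hL0' (by positivity), hL]
    push_cast
    nlinarith

/-! ### Dyadic decomposition and conclusion -/

/-- Shows that the weight `q ^ k / φ(q ^ k)` from the Gauss sums equals `q / φ(q)`. -/
theorem totient_pow_succ (q j : ℕ) :
    (q ^ (j + 1)).totient = q ^ j * q.totient := by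
  have h1 := Nat.totient_mul_prod_primeFactors (q ^ (j + 1))
  have h2 := Nat.totient_mul_prod_primeFactors q
  rw [Nat.primeFactors_pow _ (Nat.succ_ne_zero j), pow_succ, mul_assoc, ← h2, ← mul_assoc] at h1
  refine Nat.eq_of_mul_eq_mul_right ?_ h1
  exact Finset.prod_pos fun p hp => (Nat.prime_of_mem_primeFactors hp).pos

theorem natLog_two_add_one_le {Q : ℕ} (hQ : 1 ≤ Q) :
    ((Nat.log 2 Q + 1 : ℕ) : ℝ) ≤ Real.log (2 * Q) / Real.log 2 := by
  rw [le_div_iff₀ (Real.log_pos one_lt_two), ← Real.log_pow]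
  refine Real.log_le_log (by positivity) ?_
  have := Nat.pow_log_le_self 2 (by omega : Q ≠ 0)
  rw [pow_succ']
  gcongr
  exact_mod_cast this

/-- Splitting a sum over `1 ≤ q ≤ Q` into dyadic blocks. -/
theorem sum_Icc_le_of_dyadic {Q : ℕ} (hQ : 1 ≤ Q) (g : ℕ → ℝ) {B : ℝ} (hB0 : 0 ≤ B)
    (hB : ∀ P, 1 ≤ P → P ≤ Q → ∑ q ∈ Finset.Icc 1 Q with P ≤ q ∧ q < 2 * P, g q ≤ B) :
    ∑ q ∈ Finset.Icc 1 Q, g q ≤ Real.log (2 * Q) / Real.log 2 * B := by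
  have hmaps : ∀ q ∈ Finset.Icc 1 Q, Nat.log 2 q ∈ Finset.range (Nat.log 2 Q + 1) := fun q hq =>
    Finset.mem_range.mpr (Nat.lt_succ_of_le (Nat.log_mono_right (Finset.mem_Icc.mp hq).2))
  rw [← Finset.sum_fiberwise_of_maps_to hmaps]
  calc _ ≤ ∑ _i ∈ Finset.range (Nat.log 2 Q + 1), B := by
        refine Finset.sum_le_sum fun i hi => ?_
        have hfil : (Finset.Icc 1 Q).filter (fun q => Nat.log 2 q = i)
            = (Finset.Icc 1 Q).filter fun q => 2 ^ i ≤ q ∧ q < 2 * 2 ^ i := by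
          refine Finset.filter_congr fun q hq => ?_
          rw [Nat.log_eq_iff (Or.inr ⟨one_lt_two, by have := (Finset.mem_Icc.mp hq).1; omega⟩),
            pow_succ' 2 i]
        rw [hfil]
        exact hB _ Nat.one_le_two_pow (Nat.pow_le_of_le_log (by omega)
          (Nat.lt_succ_iff.mp (Finset.mem_range.mp hi)))
    _ = ((Nat.log 2 Q + 1 : ℕ) : ℝ) * B := by
        rw [Finset.sum_const, Finset.card_range, nsmul_eq_mul]
    _ ≤ _ := by
        gcongr
        exact natLog_two_add_one_le hQ

theorem corollary2 (k : ℕ) (hk : 2 ≤ k) (κ : ℝ) (hκ : κ = 2 ^ (k - 1)) (ε : ℝ) (hε : 0 < ε) :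
    ∃ C : ℝ, 0 < C ∧ ∀ (a : ℤ → ℂ) (Q N : ℕ) (M : ℤ), 1 ≤ Q → 1 ≤ N →
      ∑ q ∈ Finset.Icc 1 Q, ((q : ℝ) / (Nat.totient q : ℝ)) *
          ∑ χ ∈ primitiveDirichletCharacters (q ^ k),
            ‖∑ n ∈ Finset.Icc (M + 1) (M + (N : ℤ)), a n * χ (n : ZMod (q ^ k))‖ ^ 2
        ≤ C * (Real.log (2 * (Q : ℝ)) *
            ((Q : ℝ) ^ (k + 1) +
              (N : ℝ) ^ ε * ((N : ℝ) * (Q : ℝ) ^ ((κ - 1) / κ) +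
                (N : ℝ) ^ (1 - 1 / κ) * (Q : ℝ) ^ ((κ + (k : ℝ)) / κ))) *
            ∑ n ∈ Finset.Icc (M + 1) (M + (N : ℤ)), ‖a n‖ ^ 2) := by
  obtain ⟨j, rfl⟩ : ∃ j, k = j + 1 := ⟨k - 1, by omega⟩
  rw [Nat.add_sub_cancel] at hκ
  obtain ⟨C, hC, hcard⟩ := exists_mul_card_fractions_le j hκ hε
  have hlog2 : 0 < Real.log 2 := Real.log_pos one_lt_two
  refine ⟨12 * C / Real.log 2, by positivity, fun a Q N M hQ hN => ?_⟩
  have hκ1 : 1 ≤ κ := by rw [hκ]; exact one_le_pow₀ one_le_two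
  have hN0 : (0 : ℝ) < N := by exact_mod_cast hN
  set W : ℝ → ℝ := fun x => x ^ (j + 1 + 1) + (N : ℝ) ^ ε * ((N : ℝ) * x ^ ((κ - 1) / κ) +
    (N : ℝ) ^ (1 - 1 / κ) * x ^ ((κ + (j + 1 : ℕ)) / κ)) with hW
  -- All exponents of `x` in `W` are nonnegative, so every dyadic block obeys the bound at `Q`.
  have hmono : ∀ P : ℕ, P ≤ Q → W P ≤ W Q := by
    intro P hPQ
    have hPQ' : (P : ℝ) ≤ Q := by exact_mod_cast hPQ
    have h1 : 0 ≤ (κ - 1) / κ := div_nonneg (by linarith) (by linarith)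
    have h2 : 0 ≤ (κ + (j + 1 : ℕ)) / κ := div_nonneg (by positivity) (by linarith)
    simp only [hW]
    gcongr
  have hWQ : 0 ≤ W Q := by
    simp only [hW]
    positivity
  set Z := ∑ n ∈ Finset.Icc (M + 1) (M + (N : ℤ)), ‖a n‖ ^ 2 with hZ
  have hZ0 : 0 ≤ Z := Finset.sum_nonneg fun _ _ => by positivity
  have hblock : ∀ P, 1 ≤ P → P ≤ Q → ∑ q ∈ Finset.Icc 1 Q with P ≤ q ∧ q < 2 * P,
      ((q : ℝ) / (Nat.totient q : ℝ)) * ∑ χ ∈ primitiveDirichletCharacters (q ^ (j + 1)),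
        ‖∑ n ∈ Finset.Icc (M + 1) (M + (N : ℤ)), a n * χ (n : ZMod (q ^ (j + 1)))‖ ^ 2
      ≤ 12 * C * W Q * Z := by
    intro P hP hPQ
    have hS : ∀ q ∈ (Finset.Icc 1 Q).filter (fun q => P ≤ q ∧ q < 2 * P), 0 < q := fun q hq =>
      (Finset.mem_Icc.mp (Finset.mem_filter.mp hq).1).1
    calc _ ≤ ∑ q ∈ Finset.Icc 1 Q with P ≤ q ∧ q < 2 * P,
          ∑ c ∈ Finset.range (q ^ (j + 1)) with c.Coprime (q ^ (j + 1)),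
            ‖∑ n ∈ Finset.Icc (M + 1) (M + N), a n *
              Complex.exp (2 * Real.pi * Complex.I * (n * c) / (q ^ (j + 1) : ℕ))‖ ^ 2 := by
          refine Finset.sum_le_sum fun q hq => ?_
          have hq0 := hS q hq
          refine le_trans (le_of_eq ?_) (sum_primitiveDirichletCharacters_le (pow_pos hq0 _) _ a)
          congr 1
          rw [totient_pow_succ]
          push_cast
          have h1 : (0 : ℝ) < q.totient := by exact_mod_cast Nat.totient_pos.mpr hq0
          have h2 : (0 : ℝ) < q := by exact_mod_cast hq0
          field_simp
          ring
      -- The fraction count bounds `N * T.card`, so the spacing constant is `C * W Q / N` and the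
      -- `N` of the large sieve cancels.
      _ ≤ 12 * (C * W Q / N) * N * Z := by
          refine large_sieve_fractions (Nat.succ_ne_zero j) hN hS (fun α T hT => ?_) a M
          rw [le_div_iff₀ hN0, mul_comm]
          have h1 := hcard P N α T hP hN fun p hp =>
            have h2 := (Finset.mem_filter.mp (hT p hp).1).2
            ⟨h2.1, h2.2, (hT p hp).2⟩
          exact h1.trans (mul_le_mul_of_nonneg_left (hmono P hPQ) hC.le)
      _ = _ := by field_simp
  refine (sum_Icc_le_of_dyadic hQ _ (by positivity) hblock).trans_eq ?_
  simp only [hW]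
  ring
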